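/- **Setting.** Manifolds are finite-dimensional, real analytic, second countable and Hausdorff. Let a Lie group $G$ act from the left on a manifold $M$ such that $g\mapsto g\cdot x$ and $x\mapsto g\cdot x$ are analytic for all $x\in M$ and $g\in G$. Assume that the action is *sated*: there are no $x\in M$, no two different points $y,z\in M\setminus\{x\}$ and no sequence $(g_n)$ in $G$ with $\lim_n g_n\cdot y=x=\lim_n g_n\cdot z$. An *interval* is a connected subset of $\mathbb R$ with non-empty interior. A map on an interval $D$ is an analytic immersion (analytic embedding, analytic diffeomorphism) if it extends to an analytic immersion (an analytic immersion that is a homeomorphism onto its image, an analytic diffeomorphism onto an open interval) on an open interval containing $D$. For analytic immersions $\gamma\colon D\to M$ and $\gamma'\colon D'\to M$ write: * $\gamma\sim_\circ\gamma'$ if $\gamma(J)=\gamma'(J')$ for some non-empty open intervals $J\subseteq D$, $J'\subseteq D'$ on which $\gamma$, $\gamma'$ are embeddings; * $\gamma\simeq_{t,t'}\gamma'$ if $\gamma=\gamma'\circ\rho$ for some analytic diffeomorphism $\rho\colon D\to D'$ with $\rho(t)=t'$. Moreover, for $D=[a,b]$ write $\gamma\simeq_+\gamma'$ (resp. $\gamma\simeq_-\gamma'$)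 if * $D'=[a',b']$ and $\gamma\simeq_{a,a'}\gamma'$ (resp. $\gamma\simeq_{a,b'}\gamma'$); * $D'=[a',b')$ and $\gamma|_{[a,j)}\simeq_{a,a'}\gamma'$ (resp. $\gamma|_{(j,b]}\simeq_{b,a'}\gamma'$) for some $j$; * $D'=(a',b']$ and $\gamma|_{(j,b]}\simeq_{b,b'}\gamma'$ (resp. $\gamma|_{[a,j)}\simeq_{a,b'}\gamma'$) for some $j$. Here the excluded end point of $D'$ may be infinite, and $[a,j)$, $(j,b]$ are non-empty subsets of $[a,b]$. Write $\gamma\simeq\gamma'$ if $\gamma\simeq_+\gamma'$ or $\gamma\simeq_-\gamma'$, and let $\simeq_{(-)^n}$ be $\simeq_+$ for $n$ even and $\simeq_-$ for $n$ odd. Let $\gamma\colon I\to M$ be an analytic immersion on a non-empty open interval $I$. An interval $D\subseteq I$ is *free* if, for every $g\in G$, $g\cdot\gamma|_D\sim_\circ\gamma|_D$ implies $g\cdot\gamma|_D=\gamma|_D$. It is *maximal* if it is free and not properly contained in a free interval $D'\subseteq I$. The curve $\gamma$ is *free* if some interval $D\subseteq I$ is free. Put $G_\gamma=\{g\in G: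 g\cdot\gamma=\gamma\}$ and $[g]=g\,G_\gamma$. Let $A\subseteq I$ be a compact free interval. An *$A$-decomposition* $(\{a_n\}_{n\in\mathfrak n},\{[g_n]\}_{n\in\mathfrak n})$ of $\gamma$ consists of an index set $\mathfrak n=\{n\in\mathbb Z\setminus\{0\}: \mathfrak n_-\le n\le\mathfrak n_+\}$ with $-\infty\le\mathfrak n_-<0<\mathfrak n_+\le\infty$, points $a_n\in I$ that are strictly increasing in $n\in\mathfrak n$, and elements $g_n\in G$, such that $A=A_0$, $[g_{\pm1}]\ne[e]$, and $g_n\cdot\gamma|_A\simeq\gamma|_{A_n}$ for all $n\in\mathfrak n$. Here $A_0=[a_{-1},a_1]$, $A_n=[a_{n-1},a_n]$ for $\mathfrak n_-<n\le-1$, $A_n=[a_n,a_{n+1}]$ for $1\le n<\mathfrak n_+$, $A_{\mathfrak n_-}=I\cap(-\infty,a_{\mathfrak n_-}]$ if $\mathfrak n_-\ne-\infty$, and $A_{\mathfrak n_+}=I\cap[a_{\mathfrak n_+},\infty)$ if $\mathfrak n_+\neq\infty$. A compact free interval $B$ that admits a $B$-decomposition (with group elements $g'_n$ and intervals $B_n$)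 such that $g'_{1}\cdot\gamma|_B\simeq_-\gamma|_{B_{1}}$ and $g'_{-1}\cdot\gamma|_B\simeq_-\gamma|_{B_{-1}}$ is called *negative*. A free curve $\gamma$ is *negative* if it admits some negative interval. Define $\sigma\colon\mathbb Z\setminus\{0\}\to\{-1,1\}$ by $\sigma(n)=(-1)^{n-1}$ for $n>0$ and $\sigma(n)=(-1)^n$ for $n<0$. **Proposition.** Let $\gamma\colon I\to M$ be a free analytic immersion that is negative, and let $(\{a_n\}_{n\in\mathfrak n},\{[g_n]\}_{n\in\mathfrak n})$ be an $A$-decomposition of $\gamma$, for some compact free interval $A\subseteq I$. Then the maximal intervals are exactly the intervals $A_n$ with $n\in\mathfrak n\cup\{0\}$, and for all $n\in\mathfrak n$ we have $$g_n\cdot\gamma|_A\simeq_{(-)^n}\gamma|_{A_n}\qquad\text{and}\qquad [g_n]=[g_{\sigma(\operatorname{sign} n)}\cdots g_{\sigma(n)}],$$ where the product runs over the indices $\operatorname{sign}n,\,2\operatorname{sign}n,\,\dots,\,n$ in this order. In particular every $[g_n]$ is the class of an alternating word in $g_1$ and $g_{-1}$. -/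

import Mathlib

open Set Filter Topology
open scoped Manifold ContDiff

/-- An interval of `ℝ`: an order-connected (equivalently, connected) subset with non-empty
interior. -/
def IsIntvl (D : Set ℝ) : Prop :=
  D.OrdConnected ∧ (interior D).Nonempty

/-- A non-empty open interval (bounded or not). -/
def IsOpenIntvl (J : Set ℝ) : Prop :=
  IsOpen J ∧ J.OrdConnected ∧ J.Nonempty

section Curves

variable {E : Type*} [NormedAddCommGroup E] [NormedSpace ℝ E]
variable {M : Type*} [TopologicalSpace M] [ChartedSpace E M]

/-- `γ` is an analytic immersion on the open interval `J`. Curves are total functions `ℝ → M`,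
of which only the values on the respective interval matter. -/
def IsOpenImmersion (E : Type*) [NormedAddCommGroup E] [NormedSpace ℝ E]
    {M : Type*} [TopologicalSpace M] [ChartedSpace E M] (γ : ℝ → M) (J : Set ℝ) : Prop :=
  IsOpenIntvl J ∧ ContMDiffOn 𝓘(ℝ, ℝ) 𝓘(ℝ, E) ω γ J ∧
    ∀ t ∈ J, Function.Injective (mfderiv 𝓘(ℝ, ℝ) 𝓘(ℝ, E) γ t)

/-- `γ|_D` is an analytic immersion: it has an analytic immersive extension to some open interval
that contains `D`. -/
def IsAnalyticImmersion (E : Type*) [NormedAddCommGroup E] [NormedSpace ℝ E]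
    {M : Type*} [TopologicalSpace M] [ChartedSpace E M] (γ : ℝ → M) (D : Set ℝ) : Prop :=
  IsIntvl D ∧ ∃ (J : Set ℝ) (δ : ℝ → M), D ⊆ J ∧ EqOn δ γ D ∧ IsOpenImmersion E δ J

/-- `γ|_D` is an analytic embedding: it has an analytic immersive extension to some open interval
that contains `D`, and that extension is a homeomorphism onto its image. -/
def IsAnalyticEmbedding (E : Type*) [NormedAddCommGroup E] [NormedSpace ℝ E]
    {M : Type*} [TopologicalSpace M] [ChartedSpace E M] (γ : ℝ → M) (D : Set ℝ) : Prop :=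
  IsIntvl D ∧ ∃ (J : Set ℝ) (δ : ℝ → M), D ⊆ J ∧ EqOn δ γ D ∧ IsOpenImmersion E δ J ∧
    IsEmbedding (J.domRestrict δ)

/-- `ρ : U → V` is an analytic diffeomorphism of open intervals. -/
def IsOpenAnalyticDiffeo (ρ : ℝ → ℝ) (U V : Set ℝ) : Prop :=
  IsOpenIntvl U ∧ IsOpenIntvl V ∧ AnalyticOnNhd ℝ ρ U ∧ MapsTo ρ U V ∧
    ∃ σ : ℝ → ℝ, AnalyticOnNhd ℝ σ V ∧ MapsTo σ V U ∧ InvOn σ ρ U V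

/-- `ρ : D → D'` is an analytic diffeomorphism of intervals: it maps `D` onto `D'`, and is the
restriction of an analytic diffeomorphism of open intervals. -/
def IsAnalyticDiffeo (ρ : ℝ → ℝ) (D D' : Set ℝ) : Prop :=
  ρ '' D = D' ∧ ∃ (U V : Set ℝ) (τ : ℝ → ℝ), D ⊆ U ∧ EqOn τ ρ D ∧ IsOpenAnalyticDiffeo τ U V

/-- The relation `γ|_D ∼_∘ γ'|_{D'}`: one has `γ(J) = γ'(J')` for open intervals `J ⊆ D` and
`J' ⊆ D'` on which `γ` and `γ'` are embeddings. -/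
def Overlaps (E : Type*) [NormedAddCommGroup E] [NormedSpace ℝ E]
    {M : Type*} [TopologicalSpace M] [ChartedSpace E M]
    (γ : ℝ → M) (D : Set ℝ) (γ' : ℝ → M) (D' : Set ℝ) : Prop :=
  ∃ J J' : Set ℝ, IsOpenIntvl J ∧ IsOpenIntvl J' ∧ J ⊆ D ∧ J' ⊆ D' ∧
    IsAnalyticEmbedding E γ J ∧ IsAnalyticEmbedding E γ' J' ∧ γ '' J = γ' '' J'

end Curves

section Reparametrizations

variable {M : Type*}

/-- The relation `γ|_D ≃_{t,t'} γ'|_{D'}`: one has `γ|_D = γ' ∘ ρ` for some analytic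
diffeomorphism `ρ : D → D'` with `ρ(t) = t'`. -/
def SimAt (γ : ℝ → M) (D : Set ℝ) (t : ℝ) (γ' : ℝ → M) (D' : Set ℝ) (t' : ℝ) : Prop :=
  ∃ ρ : ℝ → ℝ, IsAnalyticDiffeo ρ D D' ∧ ρ t = t' ∧ ∀ s ∈ D, γ s = γ' (ρ s)

/-- The relation `γ|_D ≃_+ γ'|_{D'}` for `D = [a,b]` compact and `D'` of the form `[a',b']`,
`[a',b')` or `(a',b']` (where the excluded boundary point may be infinite). -/
def SimPos (γ : ℝ → M) (D : Set ℝ) (γ' : ℝ → M) (D' : Set ℝ) : Prop :=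
  ∃ a b : ℝ, a < b ∧ D = Icc a b ∧
    ((∃ a' b', IsLeast D' a' ∧ IsGreatest D' b' ∧ SimAt γ (Icc a b) a γ' D' a') ∨
     (∃ a', IsLeast D' a' ∧ (¬ ∃ b', IsGreatest D' b') ∧
        ∃ j, a < j ∧ j ≤ b ∧ SimAt γ (Ico a j) a γ' D' a') ∨
     (∃ b', IsGreatest D' b' ∧ (¬ ∃ a', IsLeast D' a') ∧
        ∃ j, a ≤ j ∧ j < b ∧ SimAt γ (Ioc j b) b γ' D' b'))

/-- The relation `γ|_D ≃_- γ'|_{D'}` for `D = [a,b]` compact and `D'` of the form `[a',b']`,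
`[a',b')` or `(a',b']` (where the excluded boundary point may be infinite). -/
def SimNeg (γ : ℝ → M) (D : Set ℝ) (γ' : ℝ → M) (D' : Set ℝ) : Prop :=
  ∃ a b : ℝ, a < b ∧ D = Icc a b ∧
    ((∃ a' b', IsLeast D' a' ∧ IsGreatest D' b' ∧ SimAt γ (Icc a b) a γ' D' b') ∨
     (∃ a', IsLeast D' a' ∧ (¬ ∃ b', IsGreatest D' b') ∧
        ∃ j, a ≤ j ∧ j < b ∧ SimAt γ (Ioc j b) b γ' D' a') ∨
     (∃ b', IsGreatest D' b' ∧ (¬ ∃ a', IsLeast D' a') ∧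
        ∃ j, a < j ∧ j ≤ b ∧ SimAt γ (Ico a j) a γ' D' b'))

/-- The relation `γ|_D ≃ γ'|_{D'}` for `D` compact. -/
def Sim (γ : ℝ → M) (D : Set ℝ) (γ' : ℝ → M) (D' : Set ℝ) : Prop :=
  SimPos γ D γ' D' ∨ SimNeg γ D γ' D'

/-- The relation `≃_{(-)^n}`: it is `≃_+` if `n` is even, and `≃_-` if `n` is odd. -/
def SimSign (n : ℤ) (γ : ℝ → M) (D : Set ℝ) (γ' : ℝ → M) (D' : Set ℝ) : Prop :=
  (Even n → SimPos γ D γ' D') ∧ (Odd n → SimNeg γ D γ' D')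

end Reparametrizations

/-- The index set `{n ∈ ℤ, n ≠ 0 | lo ≤ n ≤ hi}`; here `lo = ⊥` means `-∞` and `hi = ⊤`
means `∞`. -/
def decompIndex (lo : WithBot ℤ) (hi : WithTop ℤ) : Set ℤ :=
  {n | n ≠ 0 ∧ lo ≤ (n : WithBot ℤ) ∧ (n : WithTop ℤ) ≤ hi}

/-- `{a_n}` is a decomposition of the interval `D`, with index set given by `lo < 0 < hi`. Only
the values of `a` on the index set matter. -/
structure IsDecomposition (D : Set ℝ) (lo : WithBot ℤ) (hi : WithTop ℤ) (a : ℤ → ℝ) : Prop where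
  lo_neg : lo < ((0 : ℤ) : WithBot ℤ)
  hi_pos : ((0 : ℤ) : WithTop ℤ) < hi
  mem_interior : ∀ n ∈ decompIndex lo hi, a n ∈ interior D
  strictMonoOn : StrictMonoOn a (decompIndex lo hi)

open Classical in
/-- The intervals `A_n` that belong to a decomposition `{a_n}` of the interval `D`, for `n = 0` or
`n` in the index set. -/
noncomputable def decompPiece (D : Set ℝ) (lo : WithBot ℤ) (hi : WithTop ℤ) (a : ℤ → ℝ)
    (n : ℤ) : Set ℝ :=
  if n = 0 then Icc (a (-1)) (a 1)
  else if n < 0 then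
    if (n : WithBot ℤ) = lo then D ∩ Iic (a n) else Icc (a (n - 1)) (a n)
  else
    if (n : WithTop ℤ) = hi then D ∩ Ici (a n) else Icc (a n) (a (n + 1))

/-- The alternating sign `σ(n)`: `(-1)^(n-1)` for `n > 0`, and `(-1)^n` for `n < 0`. -/
def altSign (n : ℤ) : ℤ :=
  if 0 < n then (-1) ^ (n - 1).natAbs else (-1) ^ n.natAbs

/-- The product `g_{σ(sign n)} ⋯ g_{σ(n)}` over the indices `sign n, 2 * sign n, …, n`, in this
order. -/
def altWord {G : Type*} [Group G] (g : ℤ → G) (n : ℤ) : G :=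
  ((List.range n.natAbs).map fun k : ℕ => g (altSign (n.sign * ((k : ℤ) + 1)))).prod

section Action

variable {M : Type*} [TopologicalSpace M] (G : Type*) [Group G] [MulAction G M]

/-- The action of `G` on `M` is sated: there are no `x ∈ M`, no two different points
`y, z ∈ M \ {x}`, and no sequence `{g_n}` in `G` with `lim g_n · y = x = lim g_n · z`. -/
def IsSated (G : Type*) (M : Type*) [TopologicalSpace M] [Group G] [MulAction G M] : Prop :=
  ∀ x y z : M, y ≠ x → z ≠ x → y ≠ z → ∀ g : ℕ → G,
    ¬ (Tendsto (fun n => g n • y) atTop (𝓝 x) ∧ Tendsto (fun n => g n • z) atTop (𝓝 x))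

/-- The stabilizer `G_γ` of the curve `γ|_D`. -/
def curveStab (γ : ℝ → M) (D : Set ℝ) : Subgroup G :=
  fixingSubgroup G (γ '' D)

/-- The class `[g] = g · G_γ`, as a left coset. -/
def curveClass {G : Type*} [Group G] [MulAction G M] (γ : ℝ → M) (D : Set ℝ) (g : G) :
    G ⧸ curveStab G γ D :=
  QuotientGroup.mk g

variable (E : Type*) [NormedAddCommGroup E] [NormedSpace ℝ E] [ChartedSpace E M]

/-- `γ|_D` is a free segment: it is an analytic immersion, and `g · γ|_D ∼_∘ γ|_D` implies
`g · γ|_D = γ|_D`. -/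
def IsFreeSegment (γ : ℝ → M) (D : Set ℝ) : Prop :=
  IsAnalyticImmersion E γ D ∧
    ∀ g : G, Overlaps E (fun t => g • γ t) D γ D → ∀ t ∈ D, g • γ t = γ t

/-- `γ|_I` is a free curve: its restriction to some interval is a free segment. -/
def IsFreeCurve (γ : ℝ → M) (I : Set ℝ) : Prop :=
  ∃ D ⊆ I, IsIntvl D ∧ IsFreeSegment G E γ D

/-- `A ⊆ I` is maximal with respect to `γ|_I`: it is a free interval, and is not properly contained
in any free interval `A' ⊆ I`. -/
def IsMaximalIntvl (γ : ℝ → M) (I A : Set ℝ) : Prop :=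
  A ⊆ I ∧ IsIntvl A ∧ IsFreeSegment G E γ A ∧
    ∀ A' ⊆ I, IsIntvl A' → IsFreeSegment G E γ A' → ¬ A ⊂ A'

variable {G}

/-- `({a_n}, {[g_n]})` is an `A`-decomposition of `γ|_I`. Only the values of `a` and `g` on the
index set matter. -/
structure IsADecomposition (γ : ℝ → M) (I A : Set ℝ) (lo : WithBot ℤ) (hi : WithTop ℤ)
    (a : ℤ → ℝ) (g : ℤ → G) : Prop where
  isIntvl : IsIntvl A
  isCompact : IsCompact A
  subset : A ⊆ I
  free : IsFreeSegment G E γ A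
  decomp : IsDecomposition I lo hi a
  eq_piece : A = decompPiece I lo hi a 0
  class_one_ne : curveClass γ I (g 1) ≠ curveClass γ I 1
  class_neg_one_ne : curveClass γ I (g (-1)) ≠ curveClass γ I 1
  sim : ∀ n ∈ decompIndex lo hi, Sim (fun t => g n • γ t) A γ (decompPiece I lo hi a n)

variable (G)

/-- `B` is a negative interval of `γ|_I`: there is a `B`-decomposition with
`g_{±1} · γ|_B ≃_- γ|_{B_{±1}}`. -/
def IsNegativeIntvl (γ : ℝ → M) (I B : Set ℝ) : Prop :=
  ∃ (lo : WithBot ℤ) (hi : WithTop ℤ) (b : ℤ → ℝ) (g : ℤ → G),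
    IsADecomposition E γ I B lo hi b g ∧
    SimNeg (fun t => g 1 • γ t) B γ (decompPiece I lo hi b 1) ∧
    SimNeg (fun t => g (-1) • γ t) B γ (decompPiece I lo hi b (-1))

/-- The free curve `γ|_I` is negative: it admits some negative interval. -/
def IsNegativeCurve (γ : ℝ → M) (I : Set ℝ) : Prop :=
  ∃ B : Set ℝ, IsNegativeIntvl G E γ I B

end Action

/-! Everything is expressed through local symmetries: `LocSym γ g ε p q` says that `g` carries the
germ of `γ` at `p` to its germ at `q`, with orientation given by the sign of `ε`. By analyticity, an
element that fixes the curve near one point fixes all of it. Hence an interval is free exactly when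
all local symmetries between its interior points lie in the stabilizer (`isFreeSegment_iff`).

A reflection point is a point whose germ is reversed by an element outside the stabilizer. It cannot
be interior to a free interval, and local symmetries carry reflection points to reflection points.
So if both ends of `A` are reflection points, then all `a n` are. The pieces are free and, by
satedness, cover `I`; hence every free interval lies in one piece, and the pieces are the maximal
intervals (`isMaximalIntvl_iff`). For a negative interval `B` the ends are reflection points by
definition. Since `A` has no larger free interval around it (`subset_of_isFreeSegment`), it is one
of the pieces for `B`, so its ends are reflection points too.

For the words, two elements that carry an end of `A` to the inner end of the same piece, with `A`
pointing into that piece, agree modulo the stabilizer and have the same orientation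
(`sim_of_locSym`). The orientations agree because an immersed curve never shares a germ with its own
reversal (`not_locSym_one_neg`). If a word carries `A` to the `n`-th piece and the end `c` of `A` to
the outer end of that piece, then reflecting at `c` beforehand yields such an element for the next
piece. This appends one letter on the right and flips the orientation. -/

/-! ### Analytic curves: lifts, local injectivity, identity theorem. -/

section AnalyticCurves

variable {E : Type*} [NormedAddCommGroup E] [NormedSpace ℝ E]
variable {M : Type*} [TopologicalSpace M] [ChartedSpace E M]

/-- The curve `γ` is an analytic immersion near `t`. -/
def ImmersedAt (E : Type*) [NormedAddCommGroup E] [NormedSpace ℝ E]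
    {M : Type*} [TopologicalSpace M] [ChartedSpace E M] (γ : ℝ → M) (t : ℝ) : Prop :=
  ContMDiffAt 𝓘(ℝ, ℝ) 𝓘(ℝ, E) ω γ t ∧ Function.Injective (mfderiv 𝓘(ℝ, ℝ) 𝓘(ℝ, E) γ t)

theorem IsAnalyticImmersion.immersedAt {γ : ℝ → M} {I : Set ℝ} (hI : IsOpen I)
    (h : IsAnalyticImmersion E γ I) {t : ℝ} (ht : t ∈ I) : ImmersedAt E γ t := by
  obtain ⟨-, J, δ, hIJ, heq, hJ, hδ, hδ'⟩ := h
  have hev : γ =ᶠ[𝓝 t] δ := by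
    filter_upwards [hI.mem_nhds ht] with s hs using (heq hs).symm
  refine ⟨?_, ?_⟩
  · exact ((hδ t (hIJ ht)).contMDiffAt (hJ.1.mem_nhds (hIJ ht))).congr_of_eventuallyEq hev
  · have h1 := hδ' t (hIJ ht)
    have h2 := hev.mfderiv_eq (I := 𝓘(ℝ, ℝ)) (I' := 𝓘(ℝ, E))
    have h3 : ∀ v : TangentSpace 𝓘(ℝ, ℝ) t, (mfderiv 𝓘(ℝ, ℝ) 𝓘(ℝ, E) γ t v : E)
      = mfderiv 𝓘(ℝ, ℝ) 𝓘(ℝ, E) δ t v := fun v => congrArg (fun L : ℝ →L[ℝ] E => L v) h2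
    intro v w hvw
    exact h1 ((h3 v).symm.trans (hvw.trans (h3 w)))

theorem ImmersedAt.deriv_extChartAt_ne_zero {γ : ℝ → M} {t : ℝ} (h : ImmersedAt E γ t) :
    deriv (fun r => extChartAt 𝓘(ℝ, E) (γ t) (γ r)) t ≠ 0 := by
  intro h0
  have hd : MDifferentiableAt 𝓘(ℝ, ℝ) 𝓘(ℝ, E) γ t := h.1.mdifferentiableAt (by simp)
  have h1 := hd.mfderiv
  have h2 : (mfderiv 𝓘(ℝ, ℝ) 𝓘(ℝ, E) γ t : ℝ →L[ℝ] E) =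
      fderiv ℝ (fun r => extChartAt 𝓘(ℝ, E) (γ t) (γ r)) t := by
    rw [h1]
    simp only [mfld_simps, fderivWithin_univ]
    rfl
  have h3 : fderiv ℝ (fun r => extChartAt 𝓘(ℝ, E) (γ t) (γ r)) t (1 : ℝ) = 0 := by
    rw [← h0]; rfl
  rw [← h2] at h3
  have := h.2 (a₁ := (1 : ℝ)) (a₂ := (0 : ℝ)) (h3.trans (map_zero _).symm)
  exact (one_ne_zero : (1 : ℝ) ≠ 0) this

variable [FiniteDimensional ℝ E]

theorem ContMDiffAt.analyticAt_extChartAt {β : ℝ → M} {s : ℝ} {x : M}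
    (hβ : ContMDiffAt 𝓘(ℝ, ℝ) 𝓘(ℝ, E) ω β s) (hx : β s = x) :
    AnalyticAt ℝ (fun r => extChartAt 𝓘(ℝ, E) x (β r)) s := by
  subst hx
  have := FiniteDimensional.complete ℝ E
  have h := (contMDiffAt_iff_target.1 hβ).2
  exact (contMDiffAt_iff_contDiffAt.1 h).analyticAt

/-- An analytic curve can be lifted, near a common point, through an analytic immersion. -/
theorem ImmersedAt.exists_lift {γ β : ℝ → M} {s t : ℝ} (hγ : ImmersedAt E γ t)
    (hβ : ContMDiffAt 𝓘(ℝ, ℝ) 𝓘(ℝ, E) ω β s) (hst : β s = γ t) :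
    ∃ η : ℝ → ℝ, AnalyticAt ℝ η s ∧ η s = t ∧
      ∀ᶠ p : ℝ × ℝ in 𝓝 (s, t), β p.1 = γ p.2 → p.2 = η p.1 := by
  set ψ : ℝ → E := fun r => extChartAt 𝓘(ℝ, E) (γ t) (γ r) with hψ
  have hψa : AnalyticAt ℝ ψ t := hγ.1.analyticAt_extChartAt rfl
  -- The functional `l` is 1 on the velocity of `γ` at `t`, so `l ∘ ψ` is a real function with
  -- derivative 1. Its local inverse `k` recovers the parameter from the point.
  obtain ⟨l, hl⟩ := SeparatingDual.exists_eq_one (R := ℝ) hγ.deriv_extChartAt_ne_zero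
  have hfa : AnalyticAt ℝ (fun r => l (ψ r)) t := (l.analyticAt _).comp hψa
  have hfd : HasDerivAt (fun r => l (ψ r)) 1 t := by
    have := l.hasFDerivAt.comp_hasDerivAt t hψa.differentiableAt.hasDerivAt
    rwa [hl] at this
  have hfd' : deriv (fun r => l (ψ r)) t ≠ 0 := by rw [hfd.deriv]; exact one_ne_zero
  set f : ℝ → ℝ := fun r => l (ψ r) with hf
  have hstr := hfa.hasStrictDerivAt
  set k := hstr.localInverse _ _ _ hfd' with hk
  have hka : AnalyticAt ℝ k (f t) := hfa.analyticAt_localInverse hfd'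
  have hkf : ∀ᶠ r in 𝓝 t, k (f r) = r :=
    (hstr.hasStrictFDerivAt_equiv hfd').eventually_left_inverse
  have hba : AnalyticAt ℝ (fun r => l (extChartAt 𝓘(ℝ, E) (γ t) (β r))) s :=
    (l.analyticAt _).comp (hβ.analyticAt_extChartAt hst)
  have hbs : l (extChartAt 𝓘(ℝ, E) (γ t) (β s)) = f t := by rw [hst]
  refine ⟨fun r => k (l (extChartAt 𝓘(ℝ, E) (γ t) (β r))), ?_, ?_, ?_⟩
  · exact AnalyticAt.comp (g := k) (by rw [hbs]; exact hka) hba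
  · simp only [hbs]; exact hkf.self_of_nhds
  · filter_upwards [(continuousAt_snd (p := ((s, t) : ℝ × ℝ))).eventually hkf] with p hp hpe
    rw [hpe]; exact hp.symm

/-- Lift `γ` through itself: if the images agree, both parameters equal `η p.1`. -/
theorem ImmersedAt.eventually_injective {γ : ℝ → M} {t : ℝ} (hγ : ImmersedAt E γ t) :
    ∀ᶠ p : ℝ × ℝ in 𝓝 (t, t), γ p.1 = γ p.2 → p.1 = p.2 := by
  obtain ⟨η, -, -, hη⟩ := hγ.exists_lift hγ.1 rfl
  have hd : Tendsto (fun p : ℝ × ℝ => (p.1, p.1)) (𝓝 (t, t)) (𝓝 (t, t)) :=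
    ContinuousAt.tendsto (x := ((t, t) : ℝ × ℝ)) (f := fun p : ℝ × ℝ => (p.1, p.1)) (by fun_prop)
  filter_upwards [hη, hd.eventually hη] with p h1 h2 h
  exact (h2 rfl).trans (h1 h).symm

theorem ImmersedAt.deriv_ne_zero {γ δ : ℝ → M} {ρ : ℝ → ℝ} {t : ℝ} (hδ : ImmersedAt E δ t)
    (hγ : ContMDiffAt 𝓘(ℝ, ℝ) 𝓘(ℝ, E) ω γ (ρ t)) (hρ : AnalyticAt ℝ ρ t)
    (h : ∀ᶠ s in 𝓝 t, δ s = γ (ρ s)) : deriv ρ t ≠ 0 := by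
  intro h0
  apply hδ.deriv_extChartAt_ne_zero
  have ht : δ t = γ (ρ t) := h.self_of_nhds
  rw [ht]
  have h1 : (fun r => extChartAt 𝓘(ℝ, E) (γ (ρ t)) (δ r)) =ᶠ[𝓝 t]
      (fun r => extChartAt 𝓘(ℝ, E) (γ (ρ t)) (γ r)) ∘ ρ := by
    filter_upwards [h] with s hs
    simp [hs]
  rw [h1.deriv_eq, deriv.scomp t (hγ.analyticAt_extChartAt rfl).differentiableAt
    hρ.differentiableAt, h0, zero_smul]

/-- Zeros of analytic functions are isolated, applied in a chart. The Hausdorff property first gives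
a common value at `t`, so that one chart serves both curves. -/
theorem eventually_eq_of_frequently_eq [T2Space M] {β δ : ℝ → M} {t : ℝ}
    (hβ : ContMDiffAt 𝓘(ℝ, ℝ) 𝓘(ℝ, E) ω β t) (hδ : ContMDiffAt 𝓘(ℝ, ℝ) 𝓘(ℝ, E) ω δ t)
    (h : ∃ᶠ s in 𝓝[≠] t, β s = δ s) : ∀ᶠ s in 𝓝 t, β s = δ s := by
  have hst : β t = δ t := by
    by_contra hne
    have := (hβ.continuousAt.prodMk hδ.continuousAt).eventually
      (isClosed_diagonal.isOpen_compl.mem_nhds (show (β t, δ t) ∈ (diagonal M)ᶜ from hne))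
    obtain ⟨s, h1, h2⟩ := (h.and_eventually (this.filter_mono nhdsWithin_le_nhds)).exists
    exact h2 h1
  have h1 := hβ.analyticAt_extChartAt hst
  have h2 := hδ.analyticAt_extChartAt rfl
  have h3 := (h1.frequently_eq_iff_eventually_eq h2).1 (h.mono fun s hs => by rw [hs])
  have hb : ∀ᶠ s in 𝓝 t, β s ∈ (extChartAt 𝓘(ℝ, E) (δ t)).source :=
    hβ.continuousAt.eventually (by rw [hst]; exact extChartAt_source_mem_nhds (δ t))
  have hd : ∀ᶠ s in 𝓝 t, δ s ∈ (extChartAt 𝓘(ℝ, E) (δ t)).source :=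
    hδ.continuousAt.eventually (extChartAt_source_mem_nhds (δ t))
  filter_upwards [h3, hb, hd] with s e1 e2 e3
  exact (extChartAt 𝓘(ℝ, E) (δ t)).injOn e2 e3 e1

/-- Needed for limits of points where an identity holds locally: such points may coincide with `t`,
but then their neighbours serve instead. -/
theorem frequently_ne_of_frequently_eventually {p : ℝ → Prop} {t : ℝ}
    (h : ∃ᶠ s in 𝓝 t, ∀ᶠ r in 𝓝 s, p r) : ∃ᶠ s in 𝓝[≠] t, p s := by
  intro hn
  rw [eventually_nhdsWithin_iff] at hn
  obtain ⟨s, hs, hs'⟩ := (h.and_eventually (eventually_eventually_nhds.2 hn)).exists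
  have h2 : ∀ᶠ r in 𝓝 s, r = t := by
    filter_upwards [hs, hs'] with r h1 h2
    by_contra hne
    exact h2 hne h1
  have h3 : ∃ᶠ r in 𝓝[≠] s, r = t := (h2.filter_mono nhdsWithin_le_nhds).frequently
  have hst : s = t := h2.self_of_nhds
  obtain ⟨r, hr, hr'⟩ := (h3.and_eventually self_mem_nhdsWithin).exists
  exact hr' (hr.trans hst.symm)

/-- The identity theorem for analytic curves. -/
theorem eqOn_of_eventually_eq [T2Space M] {β δ : ℝ → M} {J : Set ℝ} (hJ : IsPreconnected J)
    (hβ : ∀ t ∈ J, ContMDiffAt 𝓘(ℝ, ℝ) 𝓘(ℝ, E) ω β t)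
    (hδ : ∀ t ∈ J, ContMDiffAt 𝓘(ℝ, ℝ) 𝓘(ℝ, E) ω δ t) {t₀ : ℝ} (ht₀ : t₀ ∈ J)
    (h : ∀ᶠ s in 𝓝 t₀, β s = δ s) : EqOn β δ J := by
  have hsub : J ⊆ {t | ∀ᶠ s in 𝓝 t, β s = δ s} := by
    refine hJ.subset_of_closure_inter_subset ?_ ⟨t₀, ht₀, h⟩ ?_
    · exact isOpen_iff_mem_nhds.2 fun t ht => eventually_eventually_nhds.2 ht
    · rintro t ⟨htc, htJ⟩
      exact eventually_eq_of_frequently_eq (hβ t htJ) (hδ t htJ)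
        (frequently_ne_of_frequently_eventually (mem_closure_iff_frequently.1 htc))
  exact fun t ht => (hsub ht).self_of_nhds

end AnalyticCurves

/-! ### Local symmetries and the stabilizer. -/

section LocalSymmetries

variable {M : Type*} {G : Type*} [Group G] [MulAction G M]

/-- `g` maps the germ of the curve `γ` at `p` to its germ at `q`, through an analytic change of
parameters whose derivative at `p` has the same sign as `ε`. -/
def LocSym (γ : ℝ → M) (g : G) (ε p q : ℝ) : Prop :=
  ∃ ρ : ℝ → ℝ, AnalyticAt ℝ ρ p ∧ ρ p = q ∧ 0 < ε * deriv ρ p ∧ ∀ᶠ t in 𝓝 p, g • γ t = γ (ρ t)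

variable {γ : ℝ → M} {g h : G} {ε δ p q r : ℝ}

theorem LocSym.comp (h₁ : LocSym γ h δ q r) (h₂ : LocSym γ g ε p q) :
    LocSym γ (h * g) (δ * ε) p r := by
  obtain ⟨ρ, hρ, hpq, hε, he⟩ := h₂
  obtain ⟨τ, hτ, hqr, hδ, hd⟩ := h₁
  subst hpq hqr
  refine ⟨τ ∘ ρ, hτ.comp hρ, rfl, ?_, ?_⟩
  · rw [deriv_comp _ hτ.differentiableAt hρ.differentiableAt]
    calc 0 < (δ * deriv τ (ρ p)) * (ε * deriv ρ p) := mul_pos hδ hε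
      _ = _ := by ring
  · filter_upwards [he, hρ.continuousAt.eventually hd] with t h1 h2
    rw [mul_smul, h1, h2, Function.comp]

/-- Moves a symmetry from `p` to nearby points. The sign of `ε * (t - p) * (s - q)` records on which
side of `q` the image lies, which allows passing from end points into the interior of an interval.
-/
theorem LocSym.eventually (h : LocSym γ g ε p q) {c : ℝ} (hc : 0 < c) :
    ∀ᶠ t in 𝓝[≠] p, ∃ s, |s - q| < c ∧ 0 < ε * (t - p) * (s - q) ∧ LocSym γ g ε t s := by
  obtain ⟨ρ, hρ, rfl, hε, he⟩ := h
  have h1 : ∀ᶠ t in 𝓝[≠] p, 0 < ε * slope ρ p t :=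
    (hρ.differentiableAt.hasDerivAt.tendsto_slope.const_mul ε).eventually (lt_mem_nhds hε)
  have h2 : ∀ᶠ t in 𝓝 p, |ρ t - ρ p| < c :=
    hρ.continuousAt.eventually (Metric.ball_mem_nhds _ hc)
  have h3 : ∀ᶠ t in 𝓝 p, 0 < ε * deriv ρ t :=
    (hρ.deriv.continuousAt.const_mul ε).eventually (lt_mem_nhds hε)
  filter_upwards [h1, h2.filter_mono nhdsWithin_le_nhds, h3.filter_mono nhdsWithin_le_nhds,
    hρ.eventually_analyticAt.filter_mono nhdsWithin_le_nhds,
    (eventually_eventually_nhds.2 he).filter_mono nhdsWithin_le_nhds, self_mem_nhdsWithin]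
    with t h1 h2 h3 h4 h5 h6
  refine ⟨ρ t, h2, ?_, ρ, h4, rfl, h3, h5⟩
  have h7 : t - p ≠ 0 := sub_ne_zero.2 h6
  rw [slope_def_field] at h1
  have : ε * (t - p) * (ρ t - ρ p) = ε * ((ρ t - ρ p) / (t - p)) * (t - p) ^ 2 := by
    field_simp
  rw [this]
  positivity

theorem LocSym.eventually_mem (h : LocSym γ g ε p q) {U : Set ℝ} (hU : U ∈ 𝓝 q) :
    ∀ᶠ t in 𝓝[≠] p, ∃ s ∈ U, 0 < ε * (t - p) * (s - q) ∧ LocSym γ g ε t s := by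
  obtain ⟨c, hc, hcU⟩ := Metric.mem_nhds_iff.1 hU
  filter_upwards [h.eventually hc] with t ⟨s, h1, h2⟩
  exact ⟨s, hcU h1, h2⟩

theorem mem_curveStab_iff {I : Set ℝ} : g ∈ curveStab G γ I ↔ ∀ t ∈ I, g • γ t = γ t := by
  simp [curveStab, mem_fixingSubgroup_iff]

theorem curveClass_eq_iff {I : Set ℝ} :
    curveClass γ I g = curveClass γ I h ↔ g⁻¹ * h ∈ curveStab G γ I :=
  QuotientGroup.eq

theorem LocSym.mul_right {I : Set ℝ} (hI : IsOpen I) (h₁ : LocSym γ g ε p q)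
    (hp : p ∈ I) (hh : h ∈ curveStab G γ I) : LocSym γ (g * h) ε p q := by
  obtain ⟨ρ, h1, h2, h3, h4⟩ := h₁
  refine ⟨ρ, h1, h2, h3, ?_⟩
  filter_upwards [h4, hI.mem_nhds hp] with t ht htI
  rw [mul_smul, mem_curveStab_iff.1 hh t htI, ht]

theorem LocSym.of_mem_curveStab {I : Set ℝ} (hI : IsOpen I) (h₁ : LocSym γ g ε p q)
    (hp : p ∈ I) (hg : g ∈ curveStab G γ I) : LocSym γ (1 : G) ε p q := by
  simpa using h₁.mul_right hI hp (inv_mem hg)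

variable [TopologicalSpace M] {E : Type*} [NormedAddCommGroup E] [NormedSpace ℝ E] [ChartedSpace E M]

theorem ImmersedAt.smul (hM : ∀ g : G, ContMDiff 𝓘(ℝ, E) 𝓘(ℝ, E) ω (fun x : M => g • x)) (g : G)
    {t : ℝ} (h : ImmersedAt E γ t) : ImmersedAt E (fun s => g • γ s) t := by
  have hd : MDifferentiableAt 𝓘(ℝ, ℝ) 𝓘(ℝ, E) (fun s => g • γ s) t :=
    ((hM g).contMDiffAt.comp t h.1).mdifferentiableAt (by simp)
  refine ⟨(hM g).contMDiffAt.comp t h.1, fun v w hvw => h.2 ?_⟩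
  have hd' : MDifferentiableAt 𝓘(ℝ, E) 𝓘(ℝ, E) (fun x : M => g⁻¹ • x) (g • γ t) :=
    (hM g⁻¹).contMDiffAt.mdifferentiableAt (by simp)
  have h1 := (hd'.hasMFDerivAt.comp t hd.hasMFDerivAt)
  have h2 : HasMFDerivAt 𝓘(ℝ, ℝ) 𝓘(ℝ, E) γ t _ := h1.congr_of_eventuallyEq
    (Eventually.of_forall fun s => by simp)
  rw [h2.mfderiv]
  exact congrArg (mfderiv 𝓘(ℝ, E) 𝓘(ℝ, E) (fun x : M => g⁻¹ • x) (g • γ t)) hvw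

variable [FiniteDimensional ℝ E]

/-- The inverse change of parameters is the lift of `g⁻¹ • γ` through `γ` at `p`. -/
theorem LocSym.inv (hM : ∀ g : G, ContMDiff 𝓘(ℝ, E) 𝓘(ℝ, E) ω (fun x : M => g • x))
    (hp : ImmersedAt E γ p) (hq : ImmersedAt E γ q) (h : LocSym γ g ε p q) :
    LocSym γ g⁻¹ ε q p := by
  obtain ⟨ρ, hρ, rfl, hε, he⟩ := h
  have hρ0 : deriv ρ p ≠ 0 := right_ne_zero_of_mul hε.ne'
  have h0 : g⁻¹ • γ (ρ p) = γ p := by rw [← he.self_of_nhds, inv_smul_smul]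
  obtain ⟨η, hη, hηq, hev⟩ := hp.exists_lift (hq.smul hM g⁻¹).1 h0
  have hc : Tendsto (fun t => (ρ t, t)) (𝓝 p) (𝓝 (ρ p, p)) :=
    (hρ.continuousAt.prodMk continuousAt_id)
  have hinv : ∀ᶠ t in 𝓝 p, t = η (ρ t) := by
    filter_upwards [hc.eventually hev, he] with t h1 h2
    exact h1 (by rw [← h2, inv_smul_smul])
  have hder : deriv η (ρ p) * deriv ρ p = 1 := by
    rw [← deriv_comp _ hη.differentiableAt hρ.differentiableAt]
    have : (η ∘ ρ) =ᶠ[𝓝 p] id := hinv.mono fun t ht => ht.symm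
    rw [this.deriv_eq, deriv_id]
  refine ⟨η, hη, hηq, ?_, ?_⟩
  · have : ε * deriv η (ρ p) = (ε * deriv ρ p) * deriv η (ρ p) ^ 2 := by
      calc ε * deriv η (ρ p) = ε * deriv η (ρ p) * (deriv η (ρ p) * deriv ρ p) := by
            rw [hder, mul_one]
        _ = _ := by ring
    have h3 : deriv η (ρ p) ≠ 0 := left_ne_zero_of_mul_eq_one hder
    rw [this]
    positivity
  · have hmap : map ρ (𝓝 p) = 𝓝 (ρ p) := hρ.hasStrictDerivAt.map_nhds_eq hρ0
    rw [← hmap, eventually_map]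
    filter_upwards [hinv, he] with t h1 h2
    rw [← h1, ← h2, inv_smul_smul]

variable [T2Space M] {I : Set ℝ}

theorem mem_curveStab_of_eventually
    (hM : ∀ g : G, ContMDiff 𝓘(ℝ, E) 𝓘(ℝ, E) ω (fun x : M => g • x)) (hI : IsPreconnected I)
    (hγ : ∀ t ∈ I, ImmersedAt E γ t) (hp : p ∈ I) (h : ∀ᶠ t in 𝓝 p, g • γ t = γ t) :
    g ∈ curveStab G γ I :=
  mem_curveStab_iff.2 <| eqOn_of_eventually_eq (E := E) hI (fun t ht => ((hγ t ht).smul hM g).1)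
    (fun t ht => (hγ t ht).1) hp h

/-- Local symmetries conjugate the stabilizer of the curve into itself. -/
theorem LocSym.mem_curveStab_of_conj
    (hM : ∀ g : G, ContMDiff 𝓘(ℝ, E) 𝓘(ℝ, E) ω (fun x : M => g • x)) (hI : IsPreconnected I)
    (hIo : IsOpen I) (hγ : ∀ t ∈ I, ImmersedAt E γ t) (hp : p ∈ I) (hq : q ∈ I)
    (hg : LocSym γ g ε p q) (hh : g⁻¹ * h * g ∈ curveStab G γ I) : h ∈ curveStab G γ I := by
  obtain ⟨ρ, hρ, hρp, -, he⟩ := hg.inv hM (hγ p hp) (hγ q hq)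
  refine mem_curveStab_of_eventually hM hI hγ hq ?_
  filter_upwards [he, hρ.continuousAt.eventually (hρp.symm ▸ hIo.mem_nhds hp)] with t h1 h2
  have h3 := mem_curveStab_iff.1 hh _ h2
  rw [← h1, smul_smul] at h3
  have h4 : g⁻¹ • h • γ t = g⁻¹ • γ t := by
    rw [← h3, smul_smul]; simp
  exact MulAction.injective g⁻¹ h4

-- Local injectivity forces the change of parameters to be the identity, whose derivative is
-- positive.
omit [T2Space M] in
theorem LocSym.one_neg_ne (hp : ImmersedAt E γ p) : ¬ LocSym γ (1 : G) (-1) p p := by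
  rintro ⟨ρ, hρ, hρp, hε, he⟩
  have hc : Tendsto (fun t => (t, ρ t)) (𝓝 p) (𝓝 (p, p)) := by
    have : Tendsto ρ (𝓝 p) (𝓝 p) := by simpa [ContinuousAt, hρp] using hρ.continuousAt
    exact tendsto_id.prodMk_nhds this
  have h1 : id =ᶠ[𝓝 p] ρ := by
    filter_upwards [hc.eventually hp.eventually_injective, he] with t h1 h2
    exact h1 (by rw [← h2, one_smul])
  rw [← h1.deriv_eq, deriv_id] at hε
  norm_num at hε

/-- The relation of having the same germ up to a reversion of the parameter is closed. -/
theorem LocSym.one_neg_closed {K : Set (ℝ × ℝ)}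
    (hγ : ∀ z ∈ K, ImmersedAt E γ z.1 ∧ ImmersedAt E γ z.2) {z : ℝ × ℝ} (hz : z ∈ K)
    (hzc : z ∈ closure {z ∈ K | LocSym γ (1 : G) (-1) z.1 z.2}) :
    LocSym γ (1 : G) (-1) z.1 z.2 := by
  obtain ⟨s, t⟩ := z
  obtain ⟨hs, ht⟩ := hγ _ hz
  simp only at hs ht
  have hst : γ s = γ t := by
    by_contra hne
    have hcont : ContinuousAt (fun z : ℝ × ℝ => (γ z.1, γ z.2)) (s, t) :=
      (hs.1.continuousAt.comp (f := Prod.fst) (x := (s, t)) continuousAt_fst).prodMk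
        (ht.1.continuousAt.comp (f := Prod.snd) (x := (s, t)) continuousAt_snd)
    have := hcont.eventually
      (isClosed_diagonal.isOpen_compl.mem_nhds (show (γ s, γ t) ∈ (diagonal M)ᶜ from hne))
    obtain ⟨z, ⟨-, ρ, -, hρ, -, he⟩, h2⟩ :=
      ((mem_closure_iff_frequently.1 hzc).and_eventually this).exists
    have h3 := he.self_of_nhds
    rw [hρ, one_smul] at h3
    exact h2 h3
  -- One lift at the limit pair contains the parameter changes of all nearby pairs, so that their
  -- properties pass to the limit.
  obtain ⟨η, hη, hηs, hev⟩ := ht.exists_lift hs.1 hst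
  have hfr : ∃ᶠ z in 𝓝 ((s, t) : ℝ × ℝ), (∀ᶠ r in 𝓝 z.1, γ r = γ (η r)) ∧ deriv η z.1 < 0 := by
    refine ((mem_closure_iff_frequently.1 hzc).and_eventually
      (eventually_eventually_nhds.2 hev)).mono ?_
    rintro ⟨s', t'⟩ ⟨⟨-, ρ, hρ, hρs, hneg, he⟩, hev'⟩
    simp only at hρ hρs hneg he ⊢
    have hc : Tendsto (fun r => (r, ρ r)) (𝓝 s') (𝓝 (s', t')) := by
      have : Tendsto ρ (𝓝 s') (𝓝 t') := by simpa [ContinuousAt, hρs] using hρ.continuousAt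
      exact tendsto_id.prodMk_nhds this
    have h1 : ρ =ᶠ[𝓝 s'] η := by
      filter_upwards [hc.eventually hev', he] with r h1 h2
      exact h1 (by rw [← h2, one_smul])
    refine ⟨?_, by rw [← h1.deriv_eq]; linarith⟩
    filter_upwards [h1, he] with r h1 h2
    rw [← h1, ← h2, one_smul]
  have hfr' : ∃ᶠ r in 𝓝 s, (∀ᶠ r' in 𝓝 r, γ r' = γ (η r')) ∧ deriv η r < 0 :=
    (continuousAt_fst (p := ((s, t) : ℝ × ℝ))).frequently hfr
  have htη : ImmersedAt E γ (η s) := by rwa [hηs]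
  have hcomp : ContMDiffAt 𝓘(ℝ, ℝ) 𝓘(ℝ, E) ω (fun r => γ (η r)) s :=
    htη.1.comp s (contMDiffAt_iff_contDiffAt.2 hη.contDiffAt)
  have heq : ∀ᶠ r in 𝓝 s, γ r = γ (η r) := eventually_eq_of_frequently_eq hs.1 hcomp
    (frequently_ne_of_frequently_eventually (hfr'.mono fun r hr => hr.1))
  -- Continuity only gives a weak inequality; it becomes strict because `γ` is immersed.
  have hle : deriv η s ≤ 0 := by
    by_contra hlt
    obtain ⟨r, h1, h2⟩ := (hfr'.and_eventually
      (hη.deriv.continuousAt.eventually (lt_mem_nhds (not_le.1 hlt)))).exists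
    linarith [h1.2]
  have hne := hs.deriv_ne_zero htη.1 hη heq
  refine ⟨η, hη, hηs, ?_, by simpa using heq⟩
  have := lt_of_le_of_ne hle hne
  simp only
  linarith

end LocalSymmetries

/-! ### Freeness in terms of local symmetries. -/

section FreeSegments

variable {M : Type*} {G : Type*} [Group G] [MulAction G M] [TopologicalSpace M]
variable {E : Type*} [NormedAddCommGroup E] [NormedSpace ℝ E] [ChartedSpace E M]
variable {γ : ℝ → M} {g h : G} {ε p q : ℝ} {I D : Set ℝ}

theorem exists_isEmbedding_domRestrict [FiniteDimensional ℝ E] [T2Space M] (hI : IsOpen I)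
    (hγ : ∀ t ∈ I, ImmersedAt E γ t) (hp : p ∈ I) :
    ∃ c > 0, ∀ J ⊆ Icc (p - c) (p + c), IsEmbedding (J.domRestrict γ) := by
  have h1 := (hγ p hp).eventually_injective
  rw [nhds_prod_eq] at h1
  obtain ⟨U, hU, hinj⟩ :=
    (Filter.eventually_prod_self_iff (r := fun s t => γ s = γ t → s = t)).1 h1
  obtain ⟨c, hc, hcs⟩ := Metric.nhds_basis_closedBall.mem_iff.1 (inter_mem hU (hI.mem_nhds hp))
  rw [Real.closedBall_eq_Icc] at hcs
  refine ⟨c, hc, fun J hJ => ?_⟩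
  have hcont : Continuous ((Icc (p - c) (p + c)).domRestrict γ) := by
    refine continuous_iff_continuousAt.2 fun t => ?_
    exact (hγ t (hcs t.2).2).1.continuousAt.comp continuousAt_subtype_val
  have hemb : IsEmbedding ((Icc (p - c) (p + c)).domRestrict γ) := by
    refine (hcont.isClosedEmbedding fun x y hxy => ?_).isEmbedding
    exact Subtype.ext (hinj _ (hcs x.2).1 _ (hcs y.2).1 hxy)
  exact hemb.comp (IsEmbedding.inclusion hJ)

theorem isAnalyticEmbedding_of_isEmbedding {J : Set ℝ} (hJ : IsOpenIntvl J)
    (hγ : ∀ t ∈ J, ImmersedAt E γ t) (hemb : IsEmbedding (J.domRestrict γ)) :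
    IsAnalyticEmbedding E γ J :=
  ⟨⟨hJ.2.1, by rw [hJ.1.interior_eq]; exact hJ.2.2⟩, J, γ, Subset.rfl, fun _ _ => rfl,
    ⟨hJ, fun t ht => (hγ t ht).1.contMDiffWithinAt, fun t ht => (hγ t ht).2⟩, hemb⟩

theorem IsAnalyticEmbedding.isEmbedding_domRestrict {J : Set ℝ} (h : IsAnalyticEmbedding E γ J) :
    IsEmbedding (J.domRestrict γ) := by
  obtain ⟨-, K, δ, hJK, heq, -, hemb⟩ := h
  have h1 : J.domRestrict γ = K.domRestrict δ ∘ inclusion hJK := by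
    ext t
    exact (heq t.2).symm
  rw [h1]
  exact hemb.comp (IsEmbedding.inclusion hJK)

variable [FiniteDimensional ℝ E] [T2Space M]

theorem LocSym.overlaps (hM : ∀ g : G, ContMDiff 𝓘(ℝ, E) 𝓘(ℝ, E) ω (fun x : M => g • x))
    (hI : IsOpen I) (hγ : ∀ t ∈ I, ImmersedAt E γ t) (hD : D ⊆ I)
    (hp : p ∈ interior D) (hq : q ∈ interior D) (h : LocSym γ g ε p q) :
    Overlaps E (fun t => g • γ t) D γ D := by
  obtain ⟨ρ, hρ, rfl, hε, he⟩ := h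
  have hρ0 : deriv ρ p ≠ 0 := right_ne_zero_of_mul hε.ne'
  have hpI := hD (interior_subset hp)
  have hqI := hD (interior_subset hq)
  have hgγ : ∀ t ∈ I, ImmersedAt E (fun s => g • γ s) t := fun t ht => (hγ t ht).smul hM g
  obtain ⟨c, hc, hemb⟩ := exists_isEmbedding_domRestrict hI hgγ hpI
  obtain ⟨d, hd, hemb'⟩ := exists_isEmbedding_domRestrict hI hγ hqI
  have hev : ∀ᶠ t in 𝓝 p, t ∈ Icc (p - c) (p + c) ∧ t ∈ interior D ∧
      ρ t ∈ Icc (ρ p - d) (ρ p + d) ∧ ρ t ∈ interior D ∧ AnalyticAt ℝ ρ t ∧ deriv ρ t ≠ 0 ∧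
      g • γ t = γ (ρ t) := by
    filter_upwards [Icc_mem_nhds (show p - c < p by linarith) (show p < p + c by linarith),
      isOpen_interior.mem_nhds hp,
      hρ.continuousAt.eventually (Icc_mem_nhds (show ρ p - d < ρ p by linarith)
        (show ρ p < ρ p + d by linarith)),
      hρ.continuousAt.eventually (isOpen_interior.mem_nhds hq), hρ.eventually_analyticAt,
      hρ.deriv.continuousAt.eventually_ne hρ0, he] with t h1 h2 h3 h4 h5 h6 h7
    exact ⟨h1, h2, h3, h4, h5, h6, h7⟩
  obtain ⟨r, hr, hball⟩ := Metric.mem_nhds_iff.1 hev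
  set J := Metric.ball p r with hJ
  have hJi : IsOpenIntvl J := by
    refine ⟨Metric.isOpen_ball, ?_, ⟨p, Metric.mem_ball_self hr⟩⟩
    rw [hJ, Real.ball_eq_Ioo]; exact ordConnected_Ioo
  have hJi' : IsOpenIntvl (ρ '' J) := by
    refine ⟨?_, ?_, hJi.2.2.image ρ⟩
    · rw [isOpen_iff_mem_nhds]
      rintro _ ⟨t, ht, rfl⟩
      have hb := hball ht
      rw [← hb.2.2.2.2.1.hasStrictDerivAt.map_nhds_eq hb.2.2.2.2.2.1]
      exact image_mem_map (hJi.1.mem_nhds ht)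
    · exact (hJi.2.1.isPreconnected.image ρ
        fun t ht => (hball ht).2.2.2.2.1.continuousAt.continuousWithinAt).ordConnected
  have hJ'D : ρ '' J ⊆ D := by
    rintro _ ⟨t, ht, rfl⟩
    exact interior_subset (hball ht).2.2.2.1
  have hJD : J ⊆ D := fun t ht => interior_subset (hball ht).2.1
  refine ⟨J, ρ '' J, hJi, hJi', hJD, hJ'D, ?_, ?_, ?_⟩
  · exact isAnalyticEmbedding_of_isEmbedding hJi (fun t ht => hgγ t (hD (hJD ht)))
      (hemb J fun t ht => (hball ht).1)
  · refine isAnalyticEmbedding_of_isEmbedding hJi' (fun t ht => hγ t (hD (hJ'D ht)))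
      (hemb' _ ?_)
    rintro _ ⟨t, ht, rfl⟩
    exact (hball ht).2.2.1
  · rw [image_image]
    exact image_congr fun t ht => (hball ht).2.2.2.2.2.2

-- The change of parameters is a lift `η` of `g • γ` through `γ`. Equality of images only gives some
-- parameter in `J'`; since `γ` is an embedding there, this parameter is close to `t`, hence equal
-- to the value of `η`.
omit [T2Space M] in
theorem Overlaps.exists_locSym (hM : ∀ g : G, ContMDiff 𝓘(ℝ, E) 𝓘(ℝ, E) ω (fun x : M => g • x))
    (hγ : ∀ t ∈ I, ImmersedAt E γ t) (hD : D ⊆ I)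
    (h : Overlaps E (fun t => g • γ t) D γ D) :
    ∃ ε, ∃ p ∈ interior D, ∃ q ∈ interior D, LocSym γ g ε p q := by
  obtain ⟨J, J', hJ, hJ', hJD, hJD', -, hemb, him⟩ := h
  obtain ⟨s, hs⟩ := hJ.2.2
  have himg : ∀ r ∈ J, ∃ t ∈ J', γ t = g • γ r := fun r hr => by
    have : g • γ r ∈ γ '' J' := him ▸ mem_image_of_mem _ hr
    exact this
  obtain ⟨t, ht, hts⟩ := himg s hs
  have hsI := hγ s (hD (hJD hs))
  have htI := hγ t (hD (hJD' ht))
  obtain ⟨η, hη, hηs, hev⟩ := htI.exists_lift (hsI.smul hM g).1 hts.symm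
  obtain ⟨U, hU, V, hV, hUV⟩ := mem_nhds_prod_iff.1 hev
  have hind := hemb.isEmbedding_domRestrict.isInducing.nhds_eq_comap ⟨t, ht⟩
  have hVm : Subtype.val ⁻¹' V ∈ 𝓝 (⟨t, ht⟩ : J') := continuous_subtype_val.continuousAt hV
  rw [hind] at hVm
  obtain ⟨W, hW, hWV⟩ := hVm
  have hW' : W ∈ 𝓝 (g • γ s) := by rw [← hts]; exact hW
  have heq : ∀ᶠ r in 𝓝 s, g • γ r = γ (η r) := by
    filter_upwards [(hsI.smul hM g).1.continuousAt hW', hU, hJ.1.mem_nhds hs] with r h1 h2 h3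
    obtain ⟨t', ht', hts'⟩ := himg r h3
    have h4 : t' ∈ V := by
      have : (⟨t', ht'⟩ : J') ∈ J'.domRestrict γ ⁻¹' W := by
        change γ t' ∈ W
        rw [hts']; exact h1
      exact hWV this
    have h5 : t' = η r := hUV (mk_mem_prod h2 h4) hts'.symm
    rw [← h5, hts']
  have hne : deriv η s ≠ 0 :=
    (hsI.smul hM g).deriv_ne_zero (by rw [hηs]; exact htI.1) hη heq
  exact ⟨deriv η s, s, interior_maximal hJD hJ.1 hs, t, interior_maximal hJD' hJ'.1 ht,
    η, hη, hηs, mul_self_pos.2 hne, heq⟩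

/-- A segment is free if and only if all its local symmetries stabilize the curve. -/
theorem isFreeSegment_iff (hM : ∀ g : G, ContMDiff 𝓘(ℝ, E) 𝓘(ℝ, E) ω (fun x : M => g • x))
    (hI : IsOpenIntvl I) (hγ : ∀ t ∈ I, ImmersedAt E γ t) (hDI : D ⊆ I) (hD : IsIntvl D) :
    IsFreeSegment G E γ D ↔ ∀ (g : G) (ε : ℝ), ∀ p ∈ interior D, ∀ q ∈ interior D,
      LocSym γ g ε p q → g ∈ curveStab G γ I := by
  constructor
  · rintro ⟨-, hfree⟩ g ε p hp q hq hL
    have hfix := hfree g (hL.overlaps hM hI.1 hγ hDI hp hq)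
    refine mem_curveStab_of_eventually hM hI.2.1.isPreconnected hγ (hDI (interior_subset hp)) ?_
    filter_upwards [isOpen_interior.mem_nhds hp] with t ht using hfix t (interior_subset ht)
  · intro hL
    refine ⟨⟨hD, I, γ, hDI, fun _ _ => rfl, hI, fun t ht => (hγ t ht).1.contMDiffWithinAt,
      fun t ht => (hγ t ht).2⟩, fun g hg t ht => ?_⟩
    obtain ⟨ε, p, hp, q, hq, h⟩ := hg.exists_locSym hM hγ hDI
    exact mem_curveStab_iff.1 (hL g ε p hp q hq h) t (hDI ht)

/-- An immersed curve does not have the same germ at two parameters up to a reversion. -/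
theorem not_locSym_one_neg (hM : ∀ g : G, ContMDiff 𝓘(ℝ, E) 𝓘(ℝ, E) ω (fun x : M => g • x))
    (hI : I.OrdConnected) (hγ : ∀ t ∈ I, ImmersedAt E γ t) (hp : p ∈ I) (hq : q ∈ I) :
    ¬ LocSym γ (1 : G) (-1) p q := by
  intro hpq
  wlog hle : p ≤ q generalizing p q
  · exact this hq hp (by simpa using hpq.inv hM (hγ p hp) (hγ q hq)) (le_of_not_ge hle)
  set K : Set (ℝ × ℝ) := {z | p ≤ z.1 ∧ z.1 ≤ z.2 ∧ z.2 ≤ q} with hK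
  have hKI : ∀ z ∈ K, z.1 ∈ I ∧ z.2 ∈ I := fun z hz =>
    ⟨hI.out hp hq ⟨hz.1, hz.2.1.trans hz.2.2⟩, hI.out hp hq ⟨hz.1.trans hz.2.1, hz.2.2⟩⟩
  have hKc : IsClosed K :=
    (isClosed_le continuous_const continuous_fst).inter
      ((isClosed_le continuous_fst continuous_snd).inter
        (isClosed_le continuous_snd continuous_const))
  have hPc : IsClosed {z ∈ K | LocSym γ (1 : G) (-1) z.1 z.2} := by
    refine isClosed_of_closure_subset fun z hz => ?_
    have hzK : z ∈ K := hKc.closure_subset (closure_mono (sep_subset _ _) hz)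
    exact ⟨hzK, LocSym.one_neg_closed
      (fun w hw => ⟨hγ _ (hKI w hw).1, hγ _ (hKI w hw).2⟩) hzK hz⟩
  have hcomp : IsCompact {z ∈ K | LocSym γ (1 : G) (-1) z.1 z.2} := by
    refine ((isCompact_Icc (a := p) (b := q)).prod (isCompact_Icc (a := p) (b := q))).of_isClosed_subset
      hPc ?_
    rintro z ⟨⟨h1, h2, h3⟩, -⟩
    exact ⟨⟨h1, h2.trans h3⟩, ⟨h1.trans h2, h3⟩⟩
  -- Among the reversed pairs in the triangle `K`, take one with minimal gap.
  obtain ⟨⟨s, t⟩, ⟨⟨h1, h2, h3⟩, hst⟩, hmin⟩ := hcomp.exists_isMinOn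
    ⟨(p, q), ⟨le_rfl, hle, le_rfl⟩, hpq⟩
    (f := fun z : ℝ × ℝ => z.2 - z.1) (by fun_prop)
  simp only at h1 h2 h3 hst
  rcases h2.eq_or_lt with rfl | hlt
  · exact LocSym.one_neg_ne (hγ s (hI.out hp hq ⟨h1, h3⟩)) hst
  -- Moving `s` to the right moves `t` to the left. The midpoint bounds keep the new pair ordered,
  -- so its gap is smaller.
  · have hev := (hst.eventually (c := (t - s) / 2) (by linarith)).filter_mono
      (nhdsWithin_mono s (fun r (hr : r ∈ Ioi s) => ne_of_gt hr))
    have hev' : ∀ᶠ r in 𝓝[>] s, r < (s + t) / 2 :=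
      (gt_mem_nhds (by linarith)).filter_mono nhdsWithin_le_nhds
    obtain ⟨r, ⟨⟨u, hu1, hu2, hu3⟩, hr⟩, hrs⟩ :=
      ((hev.and hev').and self_mem_nhdsWithin).exists
    have hrs' : s < r := hrs
    have hut : u < t := by nlinarith
    have hu4 := abs_lt.1 hu1
    have := hmin (show (r, u) ∈ _ from ⟨⟨by simp only; linarith, by simp only; linarith,
      by simp only; linarith⟩, hu3⟩)
    simp only [mem_ofPred_eq] at this
    linarith

end FreeSegments

/-! ### Diffeomorphisms of intervals at their end points. -/

section Diffeos

theorem IsIntvl.nontrivial {D : Set ℝ} (hD : IsIntvl D) : D.Nontrivial := by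
  obtain ⟨x, hx⟩ := hD.2
  exact (infinite_of_mem_nhds x (mem_interior_iff_mem_nhds.1 hx)).nontrivial

theorem IsOpenAnalyticDiffeo.deriv_ne_zero {τ : ℝ → ℝ} {U V : Set ℝ}
    (h : IsOpenAnalyticDiffeo τ U V) {s : ℝ} (hs : s ∈ U) : deriv τ s ≠ 0 := by
  obtain ⟨hU, hV, hτ, hmaps, σ, hσ, -, hinv⟩ := h
  have h1 : σ ∘ τ =ᶠ[𝓝 s] id := by
    filter_upwards [hU.1.mem_nhds hs] with r hr using hinv.1 hr
  have h2 := h1.deriv_eq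
  rw [deriv_comp _ (hσ _ (hmaps hs)).differentiableAt (hτ s hs).differentiableAt, deriv_id] at h2
  exact right_ne_zero_of_mul_eq_one h2

theorem IsOpenAnalyticDiffeo.injOn {τ : ℝ → ℝ} {U V : Set ℝ} (h : IsOpenAnalyticDiffeo τ U V) :
    InjOn τ U := by
  obtain ⟨-, -, -, -, σ, -, -, hinv⟩ := h
  exact hinv.1.injOn

/-- The derivative of a diffeomorphism of intervals at a boundary point that is mapped to a
boundary point. The signs tell on which sides of these points the intervals lie. -/
theorem IsOpenAnalyticDiffeo.sign_deriv {τ : ℝ → ℝ} {U V D : Set ℝ} {s e e' : ℝ}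
    (h : IsOpenAnalyticDiffeo τ U V) (hD : IsIntvl D) (hDU : D ⊆ U) (hs : s ∈ D) (he : e ≠ 0)
    (he' : e' ≠ 0) (h₁ : ∀ r ∈ D, 0 ≤ e * (r - s)) (h₂ : ∀ r ∈ D, 0 ≤ e' * (τ r - τ s)) :
    0 < e * e' * deriv τ s := by
  have hne := h.deriv_ne_zero (hDU hs)
  refine lt_of_le_of_ne ?_ (by simp [he, he', hne])
  by_contra hlt
  have hder := (h.2.2.1 s (hDU hs)).differentiableAt.hasDerivAt.tendsto_slope
  have hev := (hder.const_mul (e * e')).eventually (gt_mem_nhds (not_le.1 hlt))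
  have hacc : AccPt s (𝓟 D) :=
    hD.1.isPreconnected.preperfect_of_nontrivial hD.nontrivial s hs
  -- Since `s` is an accumulation point of `D`, some difference quotient with the wrong sign is
  -- taken inside `D`.
  obtain ⟨r, ⟨h3, h4⟩, h5⟩ :=
    ((accPt_iff_frequently.1 hacc).and_eventually (eventually_nhdsWithin_iff.1 hev)).exists
  have h6 := h5 h3
  rw [slope_def_field] at h6
  have h7 : r - s ≠ 0 := sub_ne_zero.2 h3
  have h8 : e * e' * ((τ r - τ s) / (r - s)) * (r - s) ^ 2
    = e * (r - s) * (e' * (τ r - τ s)) := by field_simp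
  have h9 := mul_nonneg (h₁ r h4) (h₂ r h4)
  have : 0 < (r - s) ^ 2 := by positivity
  nlinarith

theorem mem_interior_of_image {τ : ℝ → ℝ} {U V D : Set ℝ} {t : ℝ}
    (h : IsOpenAnalyticDiffeo τ U V) (hDU : D ⊆ U) (ht : t ∈ interior (τ '' D)) :
    ∃ s ∈ interior D, τ s = t := by
  obtain ⟨s, hs, rfl⟩ := interior_subset ht
  refine ⟨s, ?_, rfl⟩
  rw [mem_interior_iff_mem_nhds] at ht ⊢
  have hc := (h.2.2.1 s (hDU hs)).continuousAt ht
  filter_upwards [hc, h.1.1.mem_nhds (hDU hs)] with r h1 h2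
  obtain ⟨r', hr', heq⟩ := h1
  rwa [← h.injOn (hDU hr') h2 heq]

end Diffeos

/-! ### From reparametrizations to local symmetries. -/

section SimConsequences

variable {M : Type*} {G : Type*} [Group G] [MulAction G M] [TopologicalSpace M]
variable {E : Type*} [NormedAddCommGroup E] [NormedSpace ℝ E] [ChartedSpace E M]
variable {γ : ℝ → M} {g : G} {I D D' : Set ℝ} {α β : ℝ}
variable [FiniteDimensional ℝ E] [T2Space M]

/-- A reparametrization of a translate of the curve on an interval holds near this interval. -/
theorem SimAt.exists_diffeo (hM : ∀ g : G, ContMDiff 𝓘(ℝ, E) 𝓘(ℝ, E) ω (fun x : M => g • x))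
    (hγ : ∀ t ∈ I, ImmersedAt E γ t) (hD : IsIntvl D) (hDI : D ⊆ I)
    (hDI' : D' ⊆ I) {t t' : ℝ} (ht : t ∈ D) (h : SimAt (fun s => g • γ s) D t γ D' t') :
    ∃ (τ : ℝ → ℝ) (U V : Set ℝ), IsOpenAnalyticDiffeo τ U V ∧ D ⊆ U ∧ τ '' D = D' ∧ τ t = t' ∧
      ∀ s ∈ D, ∀ᶠ r in 𝓝 s, g • γ r = γ (τ r) := by
  obtain ⟨ρ, ⟨him, U, V, τ, hDU, heq, hdiff⟩, hρt, hρ⟩ := h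
  have him' : τ '' D = D' := by rw [← him]; exact image_congr heq
  refine ⟨τ, U, V, hdiff, hDU, him', (heq ht).trans hρt, ?_⟩
  have hcm : ∀ s ∈ D, ContMDiffAt 𝓘(ℝ, ℝ) 𝓘(ℝ, E) ω (fun r => γ (τ r)) s := fun s hs =>
    (hγ (τ s) (hDI' (him' ▸ mem_image_of_mem τ hs))).1.comp s
      (contMDiffAt_iff_contDiffAt.2 (hdiff.2.2.1 s (hDU hs)).contDiffAt)
  intro s hs
  refine eventually_eq_of_frequently_eq (E := E) ((hγ s (hDI hs)).smul hM g).1 (hcm s hs) ?_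
  -- Equality on `D` suffices, even at an end point: `D` accumulates at `s`, and the identity
  -- theorem does the rest.
  have hacc : AccPt s (𝓟 D) :=
    hD.1.isPreconnected.preperfect_of_nontrivial hD.nontrivial s hs
  rw [accPt_iff_frequently_nhdsNE] at hacc
  refine hacc.mono fun r hr => ?_
  rw [heq hr]
  exact hρ r hr

/-- The local symmetries that come from a reparametrization of a translate of the curve. -/
theorem SimAt.locSym (hM : ∀ g : G, ContMDiff 𝓘(ℝ, E) 𝓘(ℝ, E) ω (fun x : M => g • x))
    (hγ : ∀ t ∈ I, ImmersedAt E γ t) (hD : IsIntvl D) (hDI : D ⊆ I)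
    (hDI' : D' ⊆ I) {t t' : ℝ} (ht : t ∈ D) (h : SimAt (fun s => g • γ s) D t γ D' t') :
    (∀ e e' : ℝ, e ≠ 0 → e' ≠ 0 → (∀ r ∈ D, 0 ≤ e * (r - t)) → (∀ r ∈ D', 0 ≤ e' * (r - t')) →
      LocSym γ g (e * e') t t') ∧
    (∀ s' ∈ interior D', ∃ s ∈ interior D, ∃ ε, LocSym γ g ε s s') := by
  obtain ⟨τ, U, V, hdiff, hDU, rfl, rfl, hev⟩ := h.exists_diffeo hM hγ hD hDI hDI' ht
  refine ⟨fun e e' he he' h1 h2 => ?_, fun s' hs' => ?_⟩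
  · exact ⟨τ, hdiff.2.2.1 t (hDU ht), rfl, hdiff.sign_deriv hD hDU ht he he' h1
      fun r hr => h2 _ (mem_image_of_mem τ hr), hev t ht⟩
  · obtain ⟨s, hs, rfl⟩ := mem_interior_of_image hdiff hDU hs'
    have hsD := interior_subset hs
    exact ⟨s, hs, deriv τ s, τ, hdiff.2.2.1 s (hDU hsD), rfl,
      mul_self_pos.2 (hdiff.deriv_ne_zero (hDU hsD)), hev s hsD⟩

omit [TopologicalSpace M] in
/-- A reparametrization of a compact interval relates also the opposite end points. -/
theorem SimAt.opposite {c : ℝ → M} (hαβ : α < β) {a' b' : ℝ}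
    (ha' : IsLeast D' a') (hb' : IsGreatest D' b') :
    (SimAt c (Icc α β) α γ D' a' → SimAt c (Icc α β) β γ D' b') ∧
    (SimAt c (Icc α β) α γ D' b' → SimAt c (Icc α β) β γ D' a') := by
  have key : ∀ ρ : ℝ → ℝ, IsAnalyticDiffeo ρ (Icc α β) D' →
      StrictMonoOn ρ (Icc α β) ∨ StrictAntiOn ρ (Icc α β) := by
    rintro ρ ⟨-, U, V, τ, hDU, heq, hdiff⟩
    refine ContinuousOn.strictMonoOn_of_injOn_Icc' hαβ.le ?_ ?_
    · exact (hdiff.2.2.1.continuousOn.mono hDU).congr heq.symm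
    · exact (hdiff.injOn.mono hDU).congr heq
  have hα : α ∈ Icc α β := left_mem_Icc.2 hαβ.le
  have hβ : β ∈ Icc α β := right_mem_Icc.2 hαβ.le
  constructor
  · rintro ⟨ρ, hρ, hρα, h⟩
    have hβ' : ρ β ∈ D' := hρ.1 ▸ mem_image_of_mem ρ hβ
    have hmono : StrictMonoOn ρ (Icc α β) := by
      refine (key ρ hρ).resolve_right fun hanti => ?_
      have h1 := hanti hα hβ hαβ
      have h2 := ha'.2 hβ'
      linarith
    obtain ⟨y, hy, hyb⟩ : b' ∈ ρ '' Icc α β := hρ.1 ▸ hb'.1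
    refine ⟨ρ, hρ, le_antisymm (hb'.2 hβ') ?_, h⟩
    rw [← hyb]
    exact hmono.monotoneOn hy hβ hy.2
  · rintro ⟨ρ, hρ, hρα, h⟩
    have hβ' : ρ β ∈ D' := hρ.1 ▸ mem_image_of_mem ρ hβ
    have hanti : StrictAntiOn ρ (Icc α β) := by
      refine (key ρ hρ).resolve_left fun hmono => ?_
      have h1 := hmono hα hβ hαβ
      have h2 := hb'.2 hβ'
      linarith
    obtain ⟨y, hy, hya⟩ : a' ∈ ρ '' Icc α β := hρ.1 ▸ ha'.1
    refine ⟨ρ, hρ, le_antisymm ?_ (ha'.2 hβ'), h⟩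
    rw [← hya]
    exact hanti.antitoneOn hy hβ hy.2

theorem isIntvl_Icc {a b : ℝ} (h : a < b) : IsIntvl (Icc a b) :=
  ⟨ordConnected_Icc, by rwa [interior_Icc, nonempty_Ioo]⟩

theorem isIntvl_Ico {a b : ℝ} (h : a < b) : IsIntvl (Ico a b) :=
  ⟨ordConnected_Ico, by rwa [interior_Ico, nonempty_Ioo]⟩

theorem isIntvl_Ioc {a b : ℝ} (h : a < b) : IsIntvl (Ioc a b) :=
  ⟨ordConnected_Ioc, by rwa [interior_Ioc, nonempty_Ioo]⟩

theorem Icc_eq_Icc_iff_of_lt {a b c d : ℝ} (hab : a < b) (h : Icc a b = Icc c d) :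
    a = c ∧ b = d := by
  have h1 : c ≤ d := nonempty_Icc.1 (h ▸ nonempty_Icc.2 hab.le)
  exact ⟨(isLeast_Icc hab.le).unique (h ▸ isLeast_Icc h1),
    (isGreatest_Icc hab.le).unique (h ▸ isGreatest_Icc h1)⟩

/-- Only ends contained in `D'` are matched with ends of `Icc α β`. If `D'` is half-open, a part of
`Icc α β` already covers it. -/
theorem SimPos.locSym (hM : ∀ g : G, ContMDiff 𝓘(ℝ, E) 𝓘(ℝ, E) ω (fun x : M => g • x))
    (hγ : ∀ t ∈ I, ImmersedAt E γ t) (hDI : Icc α β ⊆ I) (hDI' : D' ⊆ I)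
    (h : SimPos (fun s => g • γ s) (Icc α β) γ D') :
    (∀ x, IsLeast D' x → LocSym γ g 1 α x) ∧ (∀ x, IsGreatest D' x → LocSym γ g 1 β x) ∧
    (∀ s' ∈ interior D', ∃ s ∈ interior (Icc α β), ∃ ε, LocSym γ g ε s s') := by
  obtain ⟨a, b, hab, hAB, h⟩ := h
  obtain ⟨rfl, rfl⟩ := Icc_eq_Icc_iff_of_lt hab hAB.symm
  rcases h with ⟨a', b', ha', hb', h⟩ | ⟨a', ha', hno, j, haj, hjb, h⟩ |
    ⟨b', hb', hno, j, haj, hjb, h⟩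
  · have h1 := h.locSym hM hγ (isIntvl_Icc hab) hDI hDI' (left_mem_Icc.2 hab.le)
    have h2 := ((SimAt.opposite hab ha' hb').1 h).locSym hM hγ (isIntvl_Icc hab) hDI hDI'
      (right_mem_Icc.2 hab.le)
    refine ⟨fun x hx => ?_, fun x hx => ?_, h1.2⟩
    · obtain rfl := ha'.unique hx
      simpa using h1.1 1 1 one_ne_zero one_ne_zero (fun r hr => by linarith [hr.1])
        (fun r hr => by linarith [ha'.2 hr])
    · obtain rfl := hb'.unique hx
      simpa using h2.1 (-1) (-1) (by norm_num) (by norm_num) (fun r hr => by linarith [hr.2])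
        (fun r hr => by linarith [hb'.2 hr])
  · have hsub : Ico a j ⊆ Icc a b := fun r hr => ⟨hr.1, hr.2.le.trans hjb⟩
    have h1 := h.locSym hM hγ (isIntvl_Ico haj) (hsub.trans hDI) hDI' (left_mem_Ico.2 haj)
    refine ⟨fun x hx => ?_, fun x hx => (hno ⟨x, hx⟩).elim, fun s' hs' => ?_⟩
    · obtain rfl := ha'.unique hx
      simpa using h1.1 1 1 one_ne_zero one_ne_zero (fun r hr => by linarith [hr.1])
        (fun r hr => by linarith [ha'.2 hr])
    · obtain ⟨s, hs, h2⟩ := h1.2 s' hs'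
      exact ⟨s, interior_mono hsub hs, h2⟩
  · have hsub : Ioc j b ⊆ Icc a b := fun r hr => ⟨haj.trans hr.1.le, hr.2⟩
    have h1 := h.locSym hM hγ (isIntvl_Ioc hjb) (hsub.trans hDI) hDI' (right_mem_Ioc.2 hjb)
    refine ⟨fun x hx => (hno ⟨x, hx⟩).elim, fun x hx => ?_, fun s' hs' => ?_⟩
    · obtain rfl := hb'.unique hx
      simpa using h1.1 (-1) (-1) (by norm_num) (by norm_num) (fun r hr => by linarith [hr.2])
        (fun r hr => by linarith [hb'.2 hr])
    · obtain ⟨s, hs, h2⟩ := h1.2 s' hs'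
      exact ⟨s, interior_mono hsub hs, h2⟩

theorem SimNeg.locSym (hM : ∀ g : G, ContMDiff 𝓘(ℝ, E) 𝓘(ℝ, E) ω (fun x : M => g • x))
    (hγ : ∀ t ∈ I, ImmersedAt E γ t) (hDI : Icc α β ⊆ I) (hDI' : D' ⊆ I)
    (h : SimNeg (fun s => g • γ s) (Icc α β) γ D') :
    (∀ x, IsLeast D' x → LocSym γ g (-1) β x) ∧ (∀ x, IsGreatest D' x → LocSym γ g (-1) α x) ∧
    (∀ s' ∈ interior D', ∃ s ∈ interior (Icc α β), ∃ ε, LocSym γ g ε s s') := by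
  obtain ⟨a, b, hab, hAB, h⟩ := h
  obtain ⟨rfl, rfl⟩ := Icc_eq_Icc_iff_of_lt hab hAB.symm
  rcases h with ⟨a', b', ha', hb', h⟩ | ⟨a', ha', hno, j, haj, hjb, h⟩ |
    ⟨b', hb', hno, j, haj, hjb, h⟩
  · have h1 := h.locSym hM hγ (isIntvl_Icc hab) hDI hDI' (left_mem_Icc.2 hab.le)
    have h2 := ((SimAt.opposite hab ha' hb').2 h).locSym hM hγ (isIntvl_Icc hab) hDI hDI'
      (right_mem_Icc.2 hab.le)
    refine ⟨fun x hx => ?_, fun x hx => ?_, h1.2⟩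
    · obtain rfl := ha'.unique hx
      simpa using h2.1 (-1) 1 (by norm_num) one_ne_zero (fun r hr => by linarith [hr.2])
        (fun r hr => by linarith [ha'.2 hr])
    · obtain rfl := hb'.unique hx
      simpa using h1.1 1 (-1) one_ne_zero (by norm_num) (fun r hr => by linarith [hr.1])
        (fun r hr => by linarith [hb'.2 hr])
  · have hsub : Ioc j b ⊆ Icc a b := fun r hr => ⟨haj.trans hr.1.le, hr.2⟩
    have h1 := h.locSym hM hγ (isIntvl_Ioc hjb) (hsub.trans hDI) hDI' (right_mem_Ioc.2 hjb)
    refine ⟨fun x hx => ?_, fun x hx => (hno ⟨x, hx⟩).elim, fun s' hs' => ?_⟩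
    · obtain rfl := ha'.unique hx
      simpa using h1.1 (-1) 1 (by norm_num) one_ne_zero (fun r hr => by linarith [hr.2])
        (fun r hr => by linarith [ha'.2 hr])
    · obtain ⟨s, hs, h2⟩ := h1.2 s' hs'
      exact ⟨s, interior_mono hsub hs, h2⟩
  · have hsub : Ico a j ⊆ Icc a b := fun r hr => ⟨hr.1, hr.2.le.trans hjb⟩
    have h1 := h.locSym hM hγ (isIntvl_Ico haj) (hsub.trans hDI) hDI' (left_mem_Ico.2 haj)
    refine ⟨fun x hx => (hno ⟨x, hx⟩).elim, fun x hx => ?_, fun s' hs' => ?_⟩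
    · obtain rfl := hb'.unique hx
      simpa using h1.1 1 (-1) one_ne_zero (by norm_num) (fun r hr => by linarith [hr.1])
        (fun r hr => by linarith [hb'.2 hr])
    · obtain ⟨s, hs, h2⟩ := h1.2 s' hs'
      exact ⟨s, interior_mono hsub hs, h2⟩

omit [TopologicalSpace M] in
theorem Sim.image_subset {c : ℝ → M} {D : Set ℝ} (h : Sim c D γ D') {x y : ℝ}
    (hx : IsLeast D' x) (hy : IsGreatest D' y) : ∀ s ∈ D, ∃ t ∈ D', c s = γ t := by
  have key : ∀ (E : Set ℝ) (t t' : ℝ), SimAt c E t γ D' t' → ∀ s ∈ E, ∃ t ∈ D', c s = γ t := by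
    rintro E t t' ⟨ρ, hρ, -, h⟩ s hs
    exact ⟨ρ s, hρ.1 ▸ mem_image_of_mem ρ hs, h s hs⟩
  rcases h with ⟨a, b, -, rfl, h⟩ | ⟨a, b, -, rfl, h⟩ <;>
  · rcases h with ⟨a', b', -, -, h⟩ | ⟨a', -, hno, -⟩ | ⟨b', -, hno, -⟩
    · exact key _ _ _ h
    · exact (hno ⟨y, hy⟩).elim
    · exact (hno ⟨x, hx⟩).elim

end SimConsequences

/-! ### Combinatorics of decompositions. -/

section Decompositions

/-- The index of the left end point of the `n`-th piece of a decomposition. -/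
def lowIdx (n : ℤ) : ℤ := if n ≤ 0 then n - 1 else n

/-- The index of the right end point of the `n`-th piece of a decomposition. -/
def upIdx (n : ℤ) : ℤ := if 0 ≤ n then n + 1 else n

theorem lowIdx_lt_upIdx (n : ℤ) : lowIdx n < upIdx n := by
  unfold lowIdx upIdx
  split_ifs <;> omega

variable {I : Set ℝ} {lo : WithBot ℤ} {hi : WithTop ℤ} {a : ℤ → ℝ} {n m : ℤ}

theorem mem_decompIndex_of_le (hn : n ∈ decompIndex lo hi) (h0 : lo < ((0 : ℤ) : WithBot ℤ))
    (hm : 0 < m) (hmn : m ≤ n) : m ∈ decompIndex lo hi := by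
  obtain ⟨-, -, h2⟩ := hn
  refine ⟨hm.ne', h0.le.trans (by exact_mod_cast hm.le), le_trans (by exact_mod_cast hmn) h2⟩

theorem mem_decompIndex_of_ge (hn : n ∈ decompIndex lo hi) (h0 : ((0 : ℤ) : WithTop ℤ) < hi)
    (hm : m < 0) (hmn : n ≤ m) : m ∈ decompIndex lo hi := by
  obtain ⟨-, h1, -⟩ := hn
  refine ⟨hm.ne, h1.trans (by exact_mod_cast hmn), le_trans (by exact_mod_cast hm.le) h0.le⟩

theorem lowIdx_eq_and_mem (hn : n ∈ decompIndex lo hi) (hn0 : 0 < n) :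
    lowIdx n = n ∧ lowIdx n ∈ decompIndex lo hi := by
  have : lowIdx n = n := if_neg (by omega)
  exact ⟨this, this.symm ▸ hn⟩

theorem upIdx_eq_and_mem (hn : n ∈ decompIndex lo hi) (hn0 : n < 0) :
    upIdx n = n ∧ upIdx n ∈ decompIndex lo hi := by
  have : upIdx n = n := if_neg (by omega)
  exact ⟨this, this.symm ▸ hn⟩

namespace IsDecomposition

variable (h : IsDecomposition I lo hi a)
include h

theorem one_mem : (1 : ℤ) ∈ decompIndex lo hi := by
  refine ⟨one_ne_zero, h.lo_neg.le.trans (by exact_mod_cast zero_le_one), ?_⟩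
  have := h.hi_pos
  induction hi using WithTop.recTopCoe with
  | top => exact le_top
  | coe k => exact_mod_cast (by exact_mod_cast this : (0 : ℤ) < k)

theorem neg_one_mem : (-1 : ℤ) ∈ decompIndex lo hi := by
  refine ⟨by norm_num, ?_, le_trans (by exact_mod_cast (by norm_num : (-1 : ℤ) ≤ 0)) h.hi_pos.le⟩
  have := h.lo_neg
  induction lo using WithBot.recBotCoe with
  | bot => exact bot_le
  | coe k =>
    have h1 : k < 0 := by exact_mod_cast this
    exact_mod_cast (by omega : k ≤ -1)

theorem coe_eq_hi_iff (hn : n ∈ decompIndex lo hi) (hn0 : 0 < n) :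
    (n : WithTop ℤ) = hi ↔ n + 1 ∉ decompIndex lo hi := by
  have h1 : n + 1 ∈ decompIndex lo hi ↔ ((n + 1 : ℤ) : WithTop ℤ) ≤ hi := by
    refine ⟨fun h => h.2.2, fun h' => ⟨by omega, h.lo_neg.le.trans ?_, h'⟩⟩
    exact_mod_cast (by omega : (0 : ℤ) ≤ n + 1)
  rw [h1]
  have h2 := hn.2.2
  induction hi using WithTop.recTopCoe with
  | top => simp
  | coe k =>
    norm_cast at h2 ⊢
    omega

theorem coe_eq_lo_iff (hn : n ∈ decompIndex lo hi) (hn0 : n < 0) :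
    (n : WithBot ℤ) = lo ↔ n - 1 ∉ decompIndex lo hi := by
  have h1 : n - 1 ∈ decompIndex lo hi ↔ lo ≤ ((n - 1 : ℤ) : WithBot ℤ) := by
    refine ⟨fun h => h.2.1, fun h' => ⟨by omega, h', le_trans ?_ h.hi_pos.le⟩⟩
    exact_mod_cast (by omega : n - 1 ≤ (0 : ℤ))
  rw [h1]
  have h2 := hn.2.1
  induction lo using WithBot.recBotCoe with
  | bot => simp
  | coe k =>
    norm_cast at h2 ⊢
    omega

theorem mem (hn : n ∈ decompIndex lo hi) : a n ∈ I := interior_subset (h.mem_interior n hn)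

theorem lowIdx_mem_or_upIdx_mem (hn : n = 0 ∨ n ∈ decompIndex lo hi) :
    lowIdx n ∈ decompIndex lo hi ∨ upIdx n ∈ decompIndex lo hi := by
  rcases lt_trichotomy n 0 with h0 | rfl | h0
  · exact Or.inr (upIdx_eq_and_mem (hn.resolve_left h0.ne) h0).2
  · exact Or.inr h.one_mem
  · exact Or.inl (lowIdx_eq_and_mem (hn.resolve_left h0.ne') h0).2

/-- A uniform description of all pieces: each is cut out of `I` by those of its two dividing points
whose index exists. -/
theorem mem_decompPiece_iff (hI : I.OrdConnected) (hn : n = 0 ∨ n ∈ decompIndex lo hi) {t : ℝ} :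
    t ∈ decompPiece I lo hi a n ↔ t ∈ I ∧ (lowIdx n ∈ decompIndex lo hi → a (lowIdx n) ≤ t) ∧
      (upIdx n ∈ decompIndex lo hi → t ≤ a (upIdx n)) := by
  rcases lt_trichotomy n 0 with h0 | rfl | h0
  · have hn' := hn.resolve_left h0.ne
    have h1 : lowIdx n = n - 1 := if_pos h0.le
    have h2 : upIdx n = n := if_neg (by omega)
    have h3 := h.coe_eq_lo_iff hn' h0
    rw [decompPiece, if_neg h0.ne, if_pos h0, h1, h2]
    by_cases h4 : n - 1 ∈ decompIndex lo hi
    · rw [if_neg (fun h5 => h3.1 h5 h4)]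
      simp only [h4, hn', forall_const]
      exact ⟨fun ht => ⟨hI.out (h.mem h4) (h.mem hn') ht, ht⟩, fun ht => ht.2⟩
    · rw [if_pos (h3.2 h4)]
      simp [h4, hn']
  · have h1 : lowIdx 0 = -1 := rfl
    have h2 : upIdx 0 = 1 := rfl
    rw [decompPiece, if_pos rfl, h1, h2]
    simp only [h.one_mem, h.neg_one_mem, forall_const]
    exact ⟨fun ht => ⟨hI.out (h.mem h.neg_one_mem) (h.mem h.one_mem) ht, ht⟩, fun ht => ht.2⟩
  · have hn' := hn.resolve_left h0.ne'
    have h1 : lowIdx n = n := if_neg (by omega)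
    have h2 : upIdx n = n + 1 := if_pos h0.le
    have h3 := h.coe_eq_hi_iff hn' h0
    rw [decompPiece, if_neg h0.ne', if_neg (by omega), h1, h2]
    by_cases h4 : n + 1 ∈ decompIndex lo hi
    · rw [if_neg (fun h5 => h3.1 h5 h4)]
      simp only [h4, hn', forall_const]
      exact ⟨fun ht => ⟨hI.out (h.mem hn') (h.mem h4) ht, ht⟩, fun ht => ht.2⟩
    · rw [if_pos (h3.2 h4)]
      simp [h4, hn']

theorem decompPiece_subset (hI : I.OrdConnected) (hn : n = 0 ∨ n ∈ decompIndex lo hi) :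
    decompPiece I lo hi a n ⊆ I := fun _ ht => ((h.mem_decompPiece_iff hI hn).1 ht).1

theorem isLeast_decompPiece (hI : I.OrdConnected) (hn : n = 0 ∨ n ∈ decompIndex lo hi)
    (hl : lowIdx n ∈ decompIndex lo hi) : IsLeast (decompPiece I lo hi a n) (a (lowIdx n)) := by
  refine ⟨(h.mem_decompPiece_iff hI hn).2 ⟨h.mem hl, fun _ => le_rfl, fun hu => ?_⟩,
    fun t ht => ((h.mem_decompPiece_iff hI hn).1 ht).2.1 hl⟩
  exact (h.strictMonoOn hl hu (lowIdx_lt_upIdx n)).le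

theorem isGreatest_decompPiece (hI : I.OrdConnected) (hn : n = 0 ∨ n ∈ decompIndex lo hi)
    (hu : upIdx n ∈ decompIndex lo hi) :
    IsGreatest (decompPiece I lo hi a n) (a (upIdx n)) := by
  refine ⟨(h.mem_decompPiece_iff hI hn).2 ⟨h.mem hu, fun hl => ?_, fun _ => le_rfl⟩,
    fun t ht => ((h.mem_decompPiece_iff hI hn).1 ht).2.2 hu⟩
  exact (h.strictMonoOn hl hu (lowIdx_lt_upIdx n)).le

/-- Since `I` is open, a piece without upper dividing point has no greatest element. -/
theorem upIdx_mem_of_isGreatest (hI : IsOpenIntvl I) (hn : n = 0 ∨ n ∈ decompIndex lo hi) {x : ℝ}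
    (hx : IsGreatest (decompPiece I lo hi a n) x) : upIdx n ∈ decompIndex lo hi := by
  by_contra hu
  obtain ⟨hxI, hxl, -⟩ := (h.mem_decompPiece_iff hI.2.1 hn).1 hx.1
  have hev : ∀ᶠ y in 𝓝[>] x, y ∈ I := mem_nhdsWithin_of_mem_nhds (hI.1.mem_nhds hxI)
  obtain ⟨y, hyI, hy⟩ := (hev.and self_mem_nhdsWithin).exists
  exact (not_lt.2 (hx.2 ((h.mem_decompPiece_iff hI.2.1 hn).2
    ⟨hyI, fun hl => (hxl hl).trans (le_of_lt hy), fun hu' => (hu hu').elim⟩))) hy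

theorem lowIdx_mem_of_isLeast (hI : IsOpenIntvl I) (hn : n = 0 ∨ n ∈ decompIndex lo hi) {x : ℝ}
    (hx : IsLeast (decompPiece I lo hi a n) x) : lowIdx n ∈ decompIndex lo hi := by
  by_contra hl
  obtain ⟨hxI, -, hxu⟩ := (h.mem_decompPiece_iff hI.2.1 hn).1 hx.1
  have hev : ∀ᶠ y in 𝓝[<] x, y ∈ I := mem_nhdsWithin_of_mem_nhds (hI.1.mem_nhds hxI)
  obtain ⟨y, hyI, hy⟩ := (hev.and self_mem_nhdsWithin).exists
  exact (not_lt.2 (hx.2 ((h.mem_decompPiece_iff hI.2.1 hn).2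
    ⟨hyI, fun hl' => (hl hl').elim, fun hu => (le_of_lt hy).trans (hxu hu)⟩))) hy

theorem isIntvl_decompPiece (hI : IsOpenIntvl I) (hn : n = 0 ∨ n ∈ decompIndex lo hi) :
    IsIntvl (decompPiece I lo hi a n) := by
  have hiff := fun t => h.mem_decompPiece_iff (t := t) hI.2.1 hn
  have hord : (decompPiece I lo hi a n).OrdConnected := by
    refine ⟨fun x hx y hy z hz => ?_⟩
    rw [hiff] at hx hy ⊢
    exact ⟨hI.2.1.out hx.1 hy.1 hz, fun hl => (hx.2.1 hl).trans hz.1,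
      fun hu => hz.2.trans (hy.2.2 hu)⟩
  refine ⟨hord, ?_⟩
  have key : ∀ x ∈ decompPiece I lo hi a n, ∀ y ∈ decompPiece I lo hi a n, x < y →
      (interior (decompPiece I lo hi a n)).Nonempty := fun x hx y hy hxy =>
    (nonempty_Ioo.2 hxy).mono (interior_maximal (Ioo_subset_Icc_self.trans (hord.out hx hy))
      isOpen_Ioo)
  -- With empty interior, the piece would be the single point `x`.
  have key' : ∀ x ∈ decompPiece I lo hi a n, ¬ (IsLeast (decompPiece I lo hi a n) x ∧
      IsGreatest (decompPiece I lo hi a n) x) →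
      (interior (decompPiece I lo hi a n)).Nonempty := by
    intro x hx hno
    by_contra hemp
    refine hno ⟨⟨hx, fun y hy => ?_⟩, ⟨hx, fun y hy => ?_⟩⟩
    · exact not_lt.1 fun hlt => hemp (key y hy x hx hlt)
    · exact not_lt.1 fun hlt => hemp (key x hx y hy hlt)
  have hlu : ∀ x, ¬ (IsLeast (decompPiece I lo hi a n) x ∧
      IsGreatest (decompPiece I lo hi a n) x) := by
    rintro x ⟨h1, h2⟩
    have h3 := h.lowIdx_mem_of_isLeast hI hn h1
    have h4 := h.upIdx_mem_of_isGreatest hI hn h2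
    have h5 := h1.unique (h.isLeast_decompPiece hI.2.1 hn h3)
    have h6 := h2.unique (h.isGreatest_decompPiece hI.2.1 hn h4)
    have h7 := h.strictMonoOn h3 h4 (lowIdx_lt_upIdx n)
    linarith
  rcases h.lowIdx_mem_or_upIdx_mem hn with h1 | h1
  · exact key' _ (h.isLeast_decompPiece hI.2.1 hn h1).1 (hlu _)
  · exact key' _ (h.isGreatest_decompPiece hI.2.1 hn h1).1 (hlu _)

/-- The pieces of a decomposition cover the interval unless the dividing points accumulate in
it. -/
theorem exists_mem_decompPiece (hI : I.OrdConnected)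
    (hpos : ∀ t ∈ I, ∃ k : ℤ, 1 ≤ k ∧ ¬ (k ∈ decompIndex lo hi ∧ a k ≤ t))
    (hneg : ∀ t ∈ I, ∃ k : ℤ, k ≤ -1 ∧ ¬ (k ∈ decompIndex lo hi ∧ t ≤ a k)) {t : ℝ} (ht : t ∈ I) :
    ∃ n, (n = 0 ∨ n ∈ decompIndex lo hi) ∧ t ∈ decompPiece I lo hi a n := by
  by_cases h1 : a 1 ≤ t
  -- If `k` is the first index that is missing or whose dividing point lies beyond `t`, then `t` is
  -- in the piece `k - 1`.
  · obtain ⟨k, ⟨hk1, hk⟩, hmin⟩ := Int.exists_least_of_bdd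
      (P := fun k => 1 ≤ k ∧ ¬ (k ∈ decompIndex lo hi ∧ a k ≤ t)) ⟨1, fun z hz => hz.1⟩
      (hpos t ht)
    have hk2 : k ≠ 1 := by
      rintro rfl
      exact hk ⟨h.one_mem, h1⟩
    have hP : k - 1 ∈ decompIndex lo hi ∧ a (k - 1) ≤ t := by
      by_contra hno
      have := hmin (k - 1) ⟨by omega, hno⟩
      omega
    refine ⟨k - 1, Or.inr hP.1, (h.mem_decompPiece_iff hI (Or.inr hP.1)).2 ⟨ht, ?_, ?_⟩⟩
    · rw [show lowIdx (k - 1) = k - 1 from if_neg (by omega)]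
      exact fun _ => hP.2
    · rw [show upIdx (k - 1) = k from (if_pos (by omega)).trans (by omega)]
      exact fun hm => le_of_not_ge fun hle => hk ⟨hm, hle⟩
  · by_cases h2 : t ≤ a (-1)
    · obtain ⟨k, ⟨hk1, hk⟩, hmax⟩ := Int.exists_greatest_of_bdd
        (P := fun k => k ≤ -1 ∧ ¬ (k ∈ decompIndex lo hi ∧ t ≤ a k)) ⟨-1, fun z hz => hz.1⟩
        (hneg t ht)
      have hk2 : k ≠ -1 := by
        rintro rfl
        exact hk ⟨h.neg_one_mem, h2⟩
      have hP : k + 1 ∈ decompIndex lo hi ∧ t ≤ a (k + 1) := by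
        by_contra hno
        have := hmax (k + 1) ⟨by omega, hno⟩
        omega
      refine ⟨k + 1, Or.inr hP.1, (h.mem_decompPiece_iff hI (Or.inr hP.1)).2 ⟨ht, ?_, ?_⟩⟩
      · rw [show lowIdx (k + 1) = k from (if_pos (by omega)).trans (by omega)]
        exact fun hm => le_of_not_ge fun hle => hk ⟨hm, hle⟩
      · rw [show upIdx (k + 1) = k + 1 from if_neg (by omega)]
        exact fun _ => hP.2
    · exact ⟨0, Or.inl rfl, (h.mem_decompPiece_iff hI (Or.inl rfl)).2
        ⟨ht, fun _ => (not_le.1 h2).le, fun _ => (not_le.1 h1).le⟩⟩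

end IsDecomposition

end Decompositions

/-! ### The pieces are free and cover the curve. -/

section Pieces

variable {M : Type*} {G : Type*} [Group G] [MulAction G M] [TopologicalSpace M]
variable {E : Type*} [NormedAddCommGroup E] [NormedSpace ℝ E] [ChartedSpace E M]
variable {γ : ℝ → M} {I A : Set ℝ} {lo : WithBot ℤ} {hi : WithTop ℤ} {a : ℤ → ℝ} {g : ℤ → G}

/-- The curve is mapped near `c` into itself, in a reversing way, by an element of `G` that does
not stabilize it. -/
def IsReflectionPoint (G : Type*) [Group G] [MulAction G M] (γ : ℝ → M) (I : Set ℝ) (c : ℝ) :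
    Prop :=
  ∃ s : G, s ∉ curveStab G γ I ∧ LocSym γ s (-1) c c

namespace IsADecomposition

theorem eq_Icc (h : IsADecomposition E γ I A lo hi a g) : A = Icc (a (-1)) (a 1) :=
  h.eq_piece

theorem lt (h : IsADecomposition E γ I A lo hi a g) : a (-1) < a 1 :=
  h.decomp.strictMonoOn h.decomp.neg_one_mem h.decomp.one_mem (by norm_num)

theorem one_notMem (h : IsADecomposition E γ I A lo hi a g) : g 1 ∉ curveStab G γ I := by
  intro hg
  refine h.class_one_ne (curveClass_eq_iff.2 ?_)
  rw [mul_one]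
  exact inv_mem hg

theorem neg_one_notMem (h : IsADecomposition E γ I A lo hi a g) :
    g (-1) ∉ curveStab G γ I := by
  intro hg
  refine h.class_neg_one_ne (curveClass_eq_iff.2 ?_)
  rw [mul_one]
  exact inv_mem hg

variable [FiniteDimensional ℝ E] [T2Space M]

/-- The `n`-th group element of a decomposition maps the end points of `A` to those of the `n`-th
piece, and the interior of `A` over that of the `n`-th piece. -/
theorem exists_sign (h : IsADecomposition E γ I A lo hi a g)
    (hM : ∀ g : G, ContMDiff 𝓘(ℝ, E) 𝓘(ℝ, E) ω (fun x : M => g • x)) (hI : I.OrdConnected)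
    (hγ : ∀ t ∈ I, ImmersedAt E γ t) {n : ℤ} (hn : n ∈ decompIndex lo hi) :
    ∃ ε : ℤ, (ε = 1 ∨ ε = -1) ∧
      (ε = 1 → SimPos (fun t => g n • γ t) A γ (decompPiece I lo hi a n)) ∧
      (ε = -1 → SimNeg (fun t => g n • γ t) A γ (decompPiece I lo hi a n)) ∧
      (lowIdx n ∈ decompIndex lo hi → LocSym γ (g n) (ε : ℝ) (a (-ε)) (a (lowIdx n))) ∧
      (upIdx n ∈ decompIndex lo hi → LocSym γ (g n) (ε : ℝ) (a ε) (a (upIdx n))) ∧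
      (∀ t ∈ interior (decompPiece I lo hi a n), ∃ s ∈ interior A, ∃ c, LocSym γ (g n) c s t) := by
  -- The sign is an integer because it also serves as an index: orientation `ε` takes `a (-ε)` to
  -- the left end of the piece and `a ε` to the right end.
  have hA := h.eq_Icc
  subst hA
  have hsub := h.decomp.decompPiece_subset hI (Or.inr hn)
  rcases h.sim n hn with hs | hs
  · obtain ⟨h1, h2, h3⟩ := hs.locSym hM hγ h.subset hsub
    refine ⟨1, Or.inl rfl, fun _ => hs, by norm_num, fun hl => ?_, fun hu => ?_, h3⟩
    · rw [Int.cast_one]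
      exact h1 _ (h.decomp.isLeast_decompPiece hI (Or.inr hn) hl)
    · rw [Int.cast_one]
      exact h2 _ (h.decomp.isGreatest_decompPiece hI (Or.inr hn) hu)
  · obtain ⟨h1, h2, h3⟩ := hs.locSym hM hγ h.subset hsub
    refine ⟨-1, Or.inr rfl, by norm_num, fun _ => hs, fun hl => ?_, fun hu => ?_, h3⟩
    · rw [Int.cast_neg, Int.cast_one, neg_neg]
      exact h1 _ (h.decomp.isLeast_decompPiece hI (Or.inr hn) hl)
    · rw [Int.cast_neg, Int.cast_one]
      exact h2 _ (h.decomp.isGreatest_decompPiece hI (Or.inr hn) hu)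

/-- Conjugation with `g n` turns a local symmetry of the piece into one of `A`. -/
theorem isFreeSegment_decompPiece (h : IsADecomposition E γ I A lo hi a g)
    (hM : ∀ g : G, ContMDiff 𝓘(ℝ, E) 𝓘(ℝ, E) ω (fun x : M => g • x)) (hI : IsOpenIntvl I)
    (hγ : ∀ t ∈ I, ImmersedAt E γ t) {n : ℤ} (hn : n = 0 ∨ n ∈ decompIndex lo hi) :
    IsFreeSegment G E γ (decompPiece I lo hi a n) := by
  rcases hn with rfl | hn
  · rw [← h.eq_piece]
    exact h.free
  · have hsub := h.decomp.decompPiece_subset hI.2.1 (Or.inr hn)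
    obtain ⟨-, -, -, -, -, -, hint⟩ := h.exists_sign hM hI.2.1 hγ hn
    refine (isFreeSegment_iff hM hI hγ hsub
      (h.decomp.isIntvl_decompPiece hI (Or.inr hn))).2 fun k ε p hp q hq hk => ?_
    obtain ⟨s, hs, c, hc⟩ := hint p hp
    obtain ⟨t, ht, d, hd⟩ := hint q hq
    have hsI := h.subset (interior_subset hs)
    have htI := h.subset (interior_subset ht)
    have hpI := hsub (interior_subset hp)
    have hqI := hsub (interior_subset hq)
    refine hc.mem_curveStab_of_conj hM hI.2.1.isPreconnected hI.1 hγ hsI hpI ?_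
    exact (isFreeSegment_iff hM hI hγ h.subset h.isIntvl).1 h.free _ _ s hs t ht
      (((hd.inv hM (hγ t htI) (hγ q hqI)).comp hk).comp hc)

omit [FiniteDimensional ℝ E] [T2Space M] in
/-- The points of a sequence of compact pieces do not converge to a point of the curve if the
action is sated. -/
theorem not_tendsto (h : IsADecomposition E γ I A lo hi a g) (hsat : IsSated G M)
    (hinj : ∀ t ∈ I, ∀ᶠ p : ℝ × ℝ in 𝓝 (t, t), γ p.1 = γ p.2 → p.1 = p.2) {c : ℝ}
    (hc : ContinuousAt γ c) {n : ℕ → ℤ} (hn : ∀ j, n j ∈ decompIndex lo hi) {x y : ℕ → ℝ}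
    (hx : ∀ j, IsLeast (decompPiece I lo hi a (n j)) (x j))
    (hy : ∀ j, IsGreatest (decompPiece I lo hi a (n j)) (y j))
    (hxc : Tendsto x atTop (𝓝 c)) : ¬ Tendsto y atTop (𝓝 c) := by
  intro hyc
  -- The translates of `γ s` lie on pieces that shrink to `c`, so all points of `γ '' A` are
  -- attracted to `γ c`.
  have key : ∀ s ∈ A, Tendsto (fun j => g (n j) • γ s) atTop (𝓝 (γ c)) := by
    intro s hs
    choose t ht hts using fun j => (h.sim (n j) (hn j)).image_subset (hx j) (hy j) s hs
    have h1 : Tendsto t atTop (𝓝 c) :=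
      tendsto_of_tendsto_of_tendsto_of_le_of_le hxc hyc (fun j => (hx j).2 (ht j))
        (fun j => (hy j).2 (ht j))
    exact (hc.tendsto.comp h1).congr fun j => (hts j).symm
  obtain ⟨s₀, hs₀⟩ := h.isIntvl.2
  have hin := hinj s₀ (h.subset (interior_subset hs₀))
  rw [nhds_prod_eq] at hin
  obtain ⟨U, hU, hUinj⟩ :=
    (Filter.eventually_prod_self_iff (r := fun s t => γ s = γ t → s = t)).1 hin
  have hinf : (U ∩ interior A).Infinite :=
    infinite_of_mem_nhds s₀ (inter_mem hU (isOpen_interior.mem_nhds hs₀))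
  -- Near `s₀` the curve is injective, so two distinct points other than `γ c` remain, against
  -- satedness.
  have hsub : {s ∈ U ∩ interior A | γ s = γ c}.Subsingleton := fun s hs t ht =>
    hUinj s hs.1.1 t ht.1.1 (hs.2.trans ht.2.symm)
  obtain ⟨s, ⟨hs, hsc⟩, t, ⟨ht, htc⟩, hst⟩ := (hinf.sdiff hsub.finite).nontrivial
  refine hsat (γ c) (γ s) (γ t) (fun he => hsc ⟨hs, he⟩) (fun he => htc ⟨ht, he⟩)
    (fun he => hst (hUinj s hs.1 t ht.1 he)) (fun j => g (n j))
    ⟨key s (interior_subset hs.2), key t (interior_subset ht.2)⟩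

omit [T2Space M] in
/-- The pieces of a decomposition cover the curve if the action is sated. -/
theorem exists_mem_decompPiece (h : IsADecomposition E γ I A lo hi a g) (hsat : IsSated G M)
    (hI : I.OrdConnected) (hγ : ∀ t ∈ I, ImmersedAt E γ t) {t : ℝ} (ht : t ∈ I) :
    ∃ n, (n = 0 ∨ n ∈ decompIndex lo hi) ∧ t ∈ decompPiece I lo hi a n := by
  have hinj := fun t ht => (hγ t ht).eventually_injective
  refine h.decomp.exists_mem_decompPiece hI ?_ ?_ ht
  · intro t ht
    by_contra! hno
    have hmem : ∀ j : ℕ, ((j : ℤ) + 1) ∈ decompIndex lo hi := fun j => (hno _ (by omega)).1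
    have hmono : Monotone fun j : ℕ => a ((j : ℤ) + 1) := fun i j hij =>
      h.decomp.strictMonoOn.monotoneOn (hmem i) (hmem j) (by simpa using hij)
    have hbdd : ∀ j : ℕ, a ((j : ℤ) + 1) ≤ t := fun j => (hno _ (by omega)).2
    -- Bounded dividing points converge to some `c` in `I`, and so do both ends of the successive
    -- pieces.
    have htend := tendsto_atTop_ciSup hmono ⟨t, by rintro _ ⟨j, rfl⟩; exact hbdd j⟩
    set c := ⨆ j : ℕ, a ((j : ℤ) + 1) with hc
    have hcI : c ∈ I := hI.out (h.decomp.mem (hmem 0)) ht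
      ⟨hmono.ge_of_tendsto htend 0, le_of_tendsto' htend hbdd⟩
    have hlow : ∀ j : ℕ, lowIdx ((j : ℤ) + 1) = j + 1 := fun j => if_neg (by omega)
    have hup : ∀ j : ℕ, upIdx ((j : ℤ) + 1) = ((j + 1 : ℕ) : ℤ) + 1 := fun j =>
      (if_pos (by omega)).trans (by push_cast; ring)
    refine h.not_tendsto hsat hinj (hγ c hcI).1.continuousAt hmem (fun j => ?_) (fun j => ?_)
      htend (htend.comp (tendsto_add_atTop_nat 1))
    · have := h.decomp.isLeast_decompPiece hI (Or.inr (hmem j)) (by rw [hlow]; exact hmem j)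
      rwa [hlow] at this
    · have := h.decomp.isGreatest_decompPiece hI (Or.inr (hmem j))
        (by rw [hup]; exact hmem (j + 1))
      rwa [hup] at this
  · intro t ht
    by_contra! hno
    have hmem : ∀ j : ℕ, (-(j : ℤ) - 1) ∈ decompIndex lo hi := fun j => (hno _ (by omega)).1
    have hanti : Antitone fun j : ℕ => a (-(j : ℤ) - 1) := fun i j hij =>
      h.decomp.strictMonoOn.monotoneOn (hmem j) (hmem i) (by simpa using hij)
    have hbdd : ∀ j : ℕ, t ≤ a (-(j : ℤ) - 1) := fun j => (hno _ (by omega)).2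
    have htend := tendsto_atTop_ciInf hanti ⟨t, by rintro _ ⟨j, rfl⟩; exact hbdd j⟩
    set c := ⨅ j : ℕ, a (-(j : ℤ) - 1) with hc
    have hcI : c ∈ I := hI.out ht (h.decomp.mem (hmem 0))
      ⟨ge_of_tendsto' htend hbdd, hanti.le_of_tendsto htend 0⟩
    have hup : ∀ j : ℕ, upIdx (-(j : ℤ) - 1) = -j - 1 := fun j => if_neg (by omega)
    have hlow : ∀ j : ℕ, lowIdx (-(j : ℤ) - 1) = -((j + 1 : ℕ) : ℤ) - 1 := fun j =>
      (if_pos (by omega)).trans (by push_cast; ring)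
    refine h.not_tendsto hsat hinj (hγ c hcI).1.continuousAt hmem (fun j => ?_) (fun j => ?_)
      (htend.comp (tendsto_add_atTop_nat 1)) htend
    · have := h.decomp.isLeast_decompPiece hI (Or.inr (hmem j))
        (by rw [hlow]; exact hmem (j + 1))
      rwa [hlow] at this
    · have := h.decomp.isGreatest_decompPiece hI (Or.inr (hmem j)) (by rw [hup]; exact hmem j)
      rwa [hup] at this

end IsADecomposition

/-! ### Reflection points and maximal intervals. -/

section Reflections

variable [FiniteDimensional ℝ E] [T2Space M]

/-- Conjugate the reflection at `p` by `k`; orientations multiply to `ε * -1 * ε`, which is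
negative. -/
theorem LocSym.isReflectionPoint {k : G} {ε p q : ℝ}
    (hM : ∀ g : G, ContMDiff 𝓘(ℝ, E) 𝓘(ℝ, E) ω (fun x : M => g • x)) (hI : IsOpenIntvl I)
    (hγ : ∀ t ∈ I, ImmersedAt E γ t) (hp : p ∈ I) (hq : q ∈ I) (hk : LocSym γ k ε p q)
    (h : IsReflectionPoint G γ I p) : IsReflectionPoint G γ I q := by
  obtain ⟨s, hs, hL⟩ := h
  refine ⟨k * s * k⁻¹, fun hmem => hs ?_, ?_⟩
  · refine (hk.inv hM (hγ p hp) (hγ q hq)).mem_curveStab_of_conj hM hI.2.1.isPreconnected hI.1 hγ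
      hq hp ?_
    simpa using hmem
  · obtain ⟨ρ, h1, h2, h3, h4⟩ := (hk.comp hL).comp (hk.inv hM (hγ p hp) (hγ q hq))
    refine ⟨ρ, h1, h2, ?_, h4⟩
    have h5 : ε * -1 * ε * deriv ρ q = ε ^ 2 * (-1 * deriv ρ q) := by ring
    rw [h5] at h3
    exact pos_of_mul_pos_right h3 (sq_nonneg ε)

theorem IsReflectionPoint.notMem_interior {c : ℝ} {D : Set ℝ}
    (hM : ∀ g : G, ContMDiff 𝓘(ℝ, E) 𝓘(ℝ, E) ω (fun x : M => g • x)) (hI : IsOpenIntvl I)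
    (hγ : ∀ t ∈ I, ImmersedAt E γ t) (h : IsReflectionPoint G γ I c) (hDI : D ⊆ I)
    (hD : IsIntvl D) (hfree : IsFreeSegment G E γ D) : c ∉ interior D := by
  obtain ⟨s, hs, hL⟩ := h
  exact fun hc => hs ((isFreeSegment_iff hM hI hγ hDI hD).1 hfree s _ c hc c hc hL)

namespace IsADecomposition

/-- The point `a n` is the inner end of its piece, hence the image of an end of `A` under the local
symmetry `g n`. -/
theorem isReflectionPoint (h : IsADecomposition E γ I A lo hi a g)
    (hM : ∀ g : G, ContMDiff 𝓘(ℝ, E) 𝓘(ℝ, E) ω (fun x : M => g • x)) (hI : IsOpenIntvl I)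
    (hγ : ∀ t ∈ I, ImmersedAt E γ t) (h₁ : IsReflectionPoint G γ I (a 1))
    (h₂ : IsReflectionPoint G γ I (a (-1))) {n : ℤ} (hn : n ∈ decompIndex lo hi) :
    IsReflectionPoint G γ I (a n) := by
  obtain ⟨ε, hε, -, -, hl, hu, -⟩ := h.exists_sign hM hI.2.1 hγ hn
  have hI1 := h.decomp.mem h.decomp.one_mem
  have hI2 := h.decomp.mem h.decomp.neg_one_mem
  rcases lt_or_gt_of_ne hn.1 with h0 | h0
  · obtain ⟨h3, h4⟩ := upIdx_eq_and_mem hn h0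
    have h5 := hu h4
    rw [h3] at h5
    rcases hε with rfl | rfl
    · exact h5.isReflectionPoint hM hI hγ hI1 (h.decomp.mem hn) h₁
    · exact h5.isReflectionPoint hM hI hγ hI2 (h.decomp.mem hn) h₂
  · obtain ⟨h3, h4⟩ := lowIdx_eq_and_mem hn h0
    have h5 := hl h4
    rw [h3] at h5
    rcases hε with rfl | rfl
    · exact h5.isReflectionPoint hM hI hγ hI2 (h.decomp.mem hn) h₂
    · exact h5.isReflectionPoint hM hI hγ hI1 (h.decomp.mem hn) h₁

/-- A free interval that meets a piece in an inner point is contained in that piece. -/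
theorem subset_decompPiece (h : IsADecomposition E γ I A lo hi a g)
    (hM : ∀ g : G, ContMDiff 𝓘(ℝ, E) 𝓘(ℝ, E) ω (fun x : M => g • x)) (hI : IsOpenIntvl I)
    (hγ : ∀ t ∈ I, ImmersedAt E γ t)
    (hrefl : ∀ n ∈ decompIndex lo hi, IsReflectionPoint G γ I (a n)) {D : Set ℝ} (hDI : D ⊆ I)
    (hD : IsIntvl D) (hfree : IsFreeSegment G E γ D) {n : ℤ} (hn : n = 0 ∨ n ∈ decompIndex lo hi)
    {x : ℝ} (hx : x ∈ interior D) (hxn : x ∈ decompPiece I lo hi a n) :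
    D ⊆ decompPiece I lo hi a n := by
  have hno : ∀ m ∈ decompIndex lo hi, a m ∉ interior D := fun m hm =>
    (hrefl m hm).notMem_interior hM hI hγ hDI hD hfree
  rw [h.decomp.mem_decompPiece_iff hI.2.1 hn] at hxn
  intro y hy
  refine (h.decomp.mem_decompPiece_iff hI.2.1 hn).2 ⟨hDI hy, fun hl => ?_, fun hu => ?_⟩
  · by_contra! hlt
    refine hno _ hl ?_
    rcases (hxn.2.1 hl).eq_or_lt with heq | hlt'
    · rwa [heq]
    · exact interior_maximal (Ioo_subset_Icc_self.trans (hD.1.out hy (interior_subset hx)))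
        isOpen_Ioo ⟨hlt, hlt'⟩
  · by_contra! hlt
    refine hno _ hu ?_
    rcases (hxn.2.2 hu).eq_or_lt with heq | hlt'
    · rwa [← heq]
    · exact interior_maximal (Ioo_subset_Icc_self.trans (hD.1.out (interior_subset hx) hy))
        isOpen_Ioo ⟨hlt', hlt⟩

theorem exists_subset_decompPiece (h : IsADecomposition E γ I A lo hi a g) (hsat : IsSated G M)
    (hM : ∀ g : G, ContMDiff 𝓘(ℝ, E) 𝓘(ℝ, E) ω (fun x : M => g • x)) (hI : IsOpenIntvl I)
    (hγ : ∀ t ∈ I, ImmersedAt E γ t)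
    (hrefl : ∀ n ∈ decompIndex lo hi, IsReflectionPoint G γ I (a n)) {D : Set ℝ} (hDI : D ⊆ I)
    (hD : IsIntvl D) (hfree : IsFreeSegment G E γ D) :
    ∃ n, (n = 0 ∨ n ∈ decompIndex lo hi) ∧ D ⊆ decompPiece I lo hi a n := by
  obtain ⟨x, hx⟩ := hD.2
  obtain ⟨n, hn, hxn⟩ := h.exists_mem_decompPiece hsat hI.2.1 hγ (hDI (interior_subset hx))
  exact ⟨n, hn, h.subset_decompPiece hM hI hγ hrefl hDI hD hfree hn hx hxn⟩

/-- If the dividing points are reflection points, then the pieces are the maximal intervals. -/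
theorem isMaximalIntvl_iff (h : IsADecomposition E γ I A lo hi a g) (hsat : IsSated G M)
    (hM : ∀ g : G, ContMDiff 𝓘(ℝ, E) 𝓘(ℝ, E) ω (fun x : M => g • x)) (hI : IsOpenIntvl I)
    (hγ : ∀ t ∈ I, ImmersedAt E γ t)
    (hrefl : ∀ n ∈ decompIndex lo hi, IsReflectionPoint G γ I (a n)) (B : Set ℝ) :
    IsMaximalIntvl G E γ I B ↔
      ∃ n : ℤ, (n = 0 ∨ n ∈ decompIndex lo hi) ∧ B = decompPiece I lo hi a n := by
  constructor
  · rintro ⟨hBI, hB, hfree, hmax⟩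
    obtain ⟨n, hn, hsub⟩ := h.exists_subset_decompPiece hsat hM hI hγ hrefl hBI hB hfree
    refine ⟨n, hn, hsub.antisymm ?_⟩
    by_contra hno
    exact hmax _ (h.decomp.decompPiece_subset hI.2.1 hn) (h.decomp.isIntvl_decompPiece hI hn)
      (h.isFreeSegment_decompPiece hM hI hγ hn) ⟨hsub, hno⟩
  · rintro ⟨n, hn, rfl⟩
    have hint := h.decomp.isIntvl_decompPiece hI hn
    refine ⟨h.decomp.decompPiece_subset hI.2.1 hn, hint,
      h.isFreeSegment_decompPiece hM hI hγ hn, fun B hBI hB hfree hlt => hlt.2 ?_⟩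
    obtain ⟨x, hx⟩ := hint.2
    exact h.subset_decompPiece hM hI hγ hrefl hBI hB hfree hn (interior_mono hlt.1 hx)
      (interior_subset hx)

/-- The interval of a decomposition is maximal among the free intervals. -/
theorem subset_of_isFreeSegment (h : IsADecomposition E γ I A lo hi a g)
    (hM : ∀ g : G, ContMDiff 𝓘(ℝ, E) 𝓘(ℝ, E) ω (fun x : M => g • x)) (hI : IsOpenIntvl I)
    (hγ : ∀ t ∈ I, ImmersedAt E γ t) {D : Set ℝ} (hDI : D ⊆ I) (hD : IsIntvl D)
    (hfree : IsFreeSegment G E γ D) (hAD : A ⊆ D) : D ⊆ A := by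
  have hlt := h.lt
  have hA := h.eq_Icc
  have hstab := (isFreeSegment_iff hM hI hγ hDI hD).1 hfree
  have hIoo : Ioo (a (-1)) (a 1) ⊆ interior D :=
    interior_maximal ((Ioo_subset_Icc_self.trans hA.ge).trans hAD) isOpen_Ioo
  have hl : a (-1) ∈ D := hAD (hA ▸ left_mem_Icc.2 hlt.le)
  have hr : a 1 ∈ D := hAD (hA ▸ right_mem_Icc.2 hlt.le)
  intro x hx
  rw [hA]
  refine ⟨?_, ?_⟩
  · by_contra! hxl
    have hmem : a (-1) ∈ interior D :=
      interior_maximal (Ioo_subset_Icc_self.trans (hD.1.out hx hr)) isOpen_Ioo ⟨hxl, hlt⟩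
    obtain ⟨ε, hε, -, -, -, hu, -⟩ := h.exists_sign hM hI.2.1 hγ h.decomp.neg_one_mem
    have h1 := hu h.decomp.neg_one_mem
    change LocSym γ (g (-1)) (ε : ℝ) (a ε) (a (-1)) at h1
    -- If `g (-1)` preserves orientation, it takes points of `A` near `a 1` to points near `a (-1)`;
    -- otherwise it reflects at `a (-1)`. Both are symmetries inside `D`, but `g (-1)` is not in the
    -- stabilizer.
    rcases hε with rfl | rfl
    · have h2 := (h1.eventually_mem (isOpen_interior.mem_nhds hmem)).filter_mono
        (nhdsWithin_mono (a 1) (fun r (hr : r ∈ Iio (a 1)) => ne_of_lt hr))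
      obtain ⟨r, ⟨s, hs, -, h3⟩, hr⟩ := (h2.and (Ioo_mem_nhdsLT hlt)).exists
      exact h.neg_one_notMem (hstab _ _ r (hIoo hr) s hs h3)
    · exact h.neg_one_notMem (hstab _ _ _ hmem _ hmem h1)
  · by_contra! hxr
    have hmem : a 1 ∈ interior D :=
      interior_maximal (Ioo_subset_Icc_self.trans (hD.1.out hl hx)) isOpen_Ioo ⟨hlt, hxr⟩
    obtain ⟨ε, hε, -, -, hl, -, -⟩ := h.exists_sign hM hI.2.1 hγ h.decomp.one_mem
    have h1 := hl h.decomp.one_mem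
    change LocSym γ (g 1) (ε : ℝ) (a (-ε)) (a 1) at h1
    rcases hε with rfl | rfl
    · have h2 := (h1.eventually_mem (isOpen_interior.mem_nhds hmem)).filter_mono
        (nhdsWithin_mono (a (-1)) (fun r (hr : r ∈ Ioi (a (-1))) => ne_of_gt hr))
      obtain ⟨r, ⟨s, hs, -, h3⟩, hr⟩ := (h2.and (Ioo_mem_nhdsGT hlt)).exists
      exact h.one_notMem (hstab _ _ r (hIoo hr) s hs h3)
    · exact h.one_notMem (hstab _ _ _ hmem _ hmem h1)

/-- The end points of the interval of a decomposition of a negative curve are reflection points. -/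
theorem isReflectionPoint_of_isNegativeCurve (h : IsADecomposition E γ I A lo hi a g)
    (hsat : IsSated G M)
    (hM : ∀ g : G, ContMDiff 𝓘(ℝ, E) 𝓘(ℝ, E) ω (fun x : M => g • x)) (hI : IsOpenIntvl I)
    (hγ : ∀ t ∈ I, ImmersedAt E γ t) (hneg : IsNegativeCurve G E γ I) :
    IsReflectionPoint G γ I (a 1) ∧ IsReflectionPoint G γ I (a (-1)) := by
  obtain ⟨B, lo', hi', b, k, hB, hneg₁, hneg₂⟩ := hneg
  have hBeq := hB.eq_Icc
  subst hBeq
  have h1 := hB.decomp.one_mem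
  have h2 := hB.decomp.neg_one_mem
  have hb1 : IsReflectionPoint G γ I (b 1) := ⟨k 1, hB.one_notMem,
    (hneg₁.locSym hM hγ hB.subset (hB.decomp.decompPiece_subset hI.2.1 (Or.inr h1))).1 _
      (hB.decomp.isLeast_decompPiece hI.2.1 (Or.inr h1) h1)⟩
  have hb2 : IsReflectionPoint G γ I (b (-1)) := ⟨k (-1), hB.neg_one_notMem,
    (hneg₂.locSym hM hγ hB.subset (hB.decomp.decompPiece_subset hI.2.1 (Or.inr h2))).2.1 _
      (hB.decomp.isGreatest_decompPiece hI.2.1 (Or.inr h2) h2)⟩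
  have hrefl : ∀ n ∈ decompIndex lo' hi', IsReflectionPoint G γ I (b n) := fun n hn =>
    hB.isReflectionPoint hM hI hγ hb1 hb2 hn
  obtain ⟨m, hm, hsub⟩ := hB.exists_subset_decompPiece hsat hM hI hγ hrefl h.subset h.isIntvl h.free
  -- The piece of `B` containing `A` is free, so it cannot exceed `A`.
  have heq : A = decompPiece I lo' hi' b m := hsub.antisymm <|
    h.subset_of_isFreeSegment hM hI hγ (hB.decomp.decompPiece_subset hI.2.1 hm)
      (hB.decomp.isIntvl_decompPiece hI hm) (hB.isFreeSegment_decompPiece hM hI hγ hm) hsub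
  have hl : IsLeast (decompPiece I lo' hi' b m) (a (-1)) := by
    rw [← heq, h.eq_Icc]
    exact isLeast_Icc h.lt.le
  have hg : IsGreatest (decompPiece I lo' hi' b m) (a 1) := by
    rw [← heq, h.eq_Icc]
    exact isGreatest_Icc h.lt.le
  have hl' := hB.decomp.lowIdx_mem_of_isLeast hI hm hl
  have hg' := hB.decomp.upIdx_mem_of_isGreatest hI hm hg
  rw [hl.unique (hB.decomp.isLeast_decompPiece hI.2.1 hm hl'),
    hg.unique (hB.decomp.isGreatest_decompPiece hI.2.1 hm hg')]
  exact ⟨hrefl _ hg', hrefl _ hl'⟩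

end IsADecomposition

end Reflections

end Pieces

/-! ### Alternating words. -/

section Words

theorem altSign_mul_natCast {e : ℤ} (he : e = 1 ∨ e = -1) (k : ℕ) :
    altSign (e * ((k : ℤ) + 1)) = (-1) ^ k * e := by
  rcases he with rfl | rfl
  · rw [altSign, if_pos (by omega)]
    simp
  · rw [altSign, if_neg (by omega)]
    have : (-1 * ((k : ℤ) + 1)).natAbs = k + 1 := by omega
    rw [this, pow_succ]

theorem altWord_succ {G : Type*} [Group G] (g : ℤ → G) {e : ℤ} (he : e = 1 ∨ e = -1) (k : ℕ) :
    altWord g (e * (((k + 1 : ℕ) : ℤ) + 1)) =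
      altWord g (e * ((k : ℤ) + 1)) * g ((-1) ^ (k + 1) * e) := by
  have h1 : ∀ j : ℕ, (e * ((j : ℤ) + 1)).natAbs = j + 1 := fun j => by
    rcases he with rfl | rfl <;> omega
  have h2 : ∀ j : ℕ, (e * ((j : ℤ) + 1)).sign = e := fun j => by
    rcases he with rfl | rfl
    · exact Int.sign_eq_one_of_pos (by omega)
    · exact Int.sign_eq_neg_one_of_neg (by omega)
  simp only [altWord, h1, h2]
  rw [List.range_succ, List.map_append, List.prod_append]
  simp only [List.map_cons, List.map_nil, List.prod_cons, List.prod_nil, mul_one,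
    altSign_mul_natCast he]

theorem altWord_of_eq {G : Type*} [Group G] (g : ℤ → G) {e : ℤ} (he : e = 1 ∨ e = -1) :
    altWord g e = g e := by
  rcases he with rfl | rfl <;> simp [altWord, altSign]

variable {M : Type*} {G : Type*} [Group G] [MulAction G M] [TopologicalSpace M]
variable {E : Type*} [NormedAddCommGroup E] [NormedSpace ℝ E] [ChartedSpace E M]
variable {γ : ℝ → M} {I A : Set ℝ} {lo : WithBot ℤ} {hi : WithTop ℤ} {a : ℤ → ℝ} {g : ℤ → G}
variable [FiniteDimensional ℝ E] [T2Space M]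

namespace IsADecomposition

/-- In each of the eight sign cases, `hts` says that `s` moves from its end of `A` inwards, and `hs`
keeps it short of the other end. -/
theorem mem_Ioo_of_sign {a : ℤ → ℝ} {δ ε : ℤ} (hδ : δ = 1 ∨ δ = -1)
    (hε : ε = 1 ∨ ε = -1) {e : ℤ} (he : e = 1 ∨ e = -1) {t s : ℝ} (ht : t ∈ Ioo (a (-1)) (a 1))
    (hs : |s - a (-(ε * e))| < a 1 - a (-1))
    (hts : 0 < (ε : ℝ) * δ * (t - a (-(δ * e))) * (s - a (-(ε * e)))) :
    s ∈ Ioo (a (-1)) (a 1) := by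
  obtain ⟨h1, h2⟩ := ht
  rw [abs_lt] at hs
  rcases hδ with rfl | rfl <;> rcases hε with rfl | rfl <;> rcases he with rfl | rfl <;>
  · norm_num at hs hts
    constructor <;> nlinarith

/-- A local symmetry that maps `A` into the `n`-th piece, at the inner end of the latter,
determines the class and the orientation of the `n`-th group element. -/
theorem sim_of_locSym (h : IsADecomposition E γ I A lo hi a g)
    (hM : ∀ g : G, ContMDiff 𝓘(ℝ, E) 𝓘(ℝ, E) ω (fun x : M => g • x)) (hI : IsOpenIntvl I)
    (hγ : ∀ t ∈ I, ImmersedAt E γ t) {n e δ : ℤ} (hn : n ∈ decompIndex lo hi)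
    (he : e = 1 ∨ e = -1) (hen : 0 < e * n) (hδ : δ = 1 ∨ δ = -1) {k : G}
    (hk : LocSym γ k (δ : ℝ) (a (-(δ * e))) (a n)) :
    (g n)⁻¹ * k ∈ curveStab G γ I ∧
    (δ = 1 → SimPos (fun t => g n • γ t) A γ (decompPiece I lo hi a n)) ∧
    (δ = -1 → SimNeg (fun t => g n • γ t) A γ (decompPiece I lo hi a n)) ∧
    LocSym γ (g n) (δ : ℝ) (a (-(δ * e))) (a n) ∧
    (n + e ∈ decompIndex lo hi → LocSym γ (g n) (δ : ℝ) (a (δ * e)) (a (n + e))) := by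
  have hmem : ∀ c : ℤ, c = 1 ∨ c = -1 → a c ∈ I := by
    rintro c (rfl | rfl)
    · exact h.decomp.mem h.decomp.one_mem
    · exact h.decomp.mem h.decomp.neg_one_mem
  have hsign : ∀ c : ℤ, c = 1 ∨ c = -1 → -(c * e) = 1 ∨ -(c * e) = -1 := by
    rintro c (rfl | rfl) <;> rcases he with rfl | rfl <;> norm_num
  obtain ⟨ε, hε, hpos, hneg, hl, hu, -⟩ := h.exists_sign hM hI.2.1 hγ hn
  have hent : LocSym γ (g n) (ε : ℝ) (a (-(ε * e))) (a n) := by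
    rcases he with rfl | rfl
    · obtain ⟨h1, h2⟩ := lowIdx_eq_and_mem hn (by omega)
      simpa [h1] using hl h2
    · obtain ⟨h1, h2⟩ := upIdx_eq_and_mem hn (by omega)
      simpa [h1] using hu h2
  have hexit : n + e ∈ decompIndex lo hi →
      LocSym γ (g n) (ε : ℝ) (a (ε * e)) (a (n + e)) := by
    intro hne
    rcases he with rfl | rfl
    · have h1 : upIdx n = n + 1 := if_pos (by omega)
      rw [mul_one, ← h1]
      exact hu (h1 ▸ hne)
    · have h1 : lowIdx n = n + -1 := (if_pos (by omega)).trans (by ring)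
      rw [mul_neg_one, ← h1]
      exact hl (h1 ▸ hne)
  have hpI := hmem _ (hsign δ hδ)
  have hqI := hmem _ (hsign ε hε)
  -- This composition takes an end of `A` to an end of `A` with inner side to inner side; at nearby
  -- interior points freeness applies.
  have hcomp := (hent.inv hM (hγ _ hqI) (hγ _ (h.decomp.mem hn))).comp hk
  have hIoo : Ioo (a (-1)) (a 1) ⊆ interior A := by
    rw [h.eq_Icc, interior_Icc]
  have hne : (𝓝[Ioo (a (-1)) (a 1)] a (-(δ * e))).NeBot := by
    rw [← mem_closure_iff_nhdsWithin_neBot, closure_Ioo h.lt.ne]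
    rcases hsign δ hδ with h1 | h1 <;> rw [h1]
    · exact right_mem_Icc.2 h.lt.le
    · exact left_mem_Icc.2 h.lt.le
  have hev := (hcomp.eventually (sub_pos.2 h.lt)).filter_mono
    (nhdsWithin_mono (a (-(δ * e))) (fun r (hr : r ∈ Ioo (a (-1)) (a 1)) => by
      rcases hsign δ hδ with h1 | h1 <;> rw [h1]
      · exact hr.2.ne
      · exact hr.1.ne'))
  obtain ⟨t, ⟨s, hs1, hs2, hs3⟩, ht⟩ := (hev.and self_mem_nhdsWithin).exists
  have hs : s ∈ Ioo (a (-1)) (a 1) := mem_Ioo_of_sign hδ hε he ht hs1 hs2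
  have hstab := (isFreeSegment_iff hM hI hγ h.subset h.isIntvl).1 h.free _ _ t (hIoo ht) s
    (hIoo hs) hs3
  have htI := h.subset (interior_subset (hIoo ht))
  have hsI := h.subset (interior_subset (hIoo hs))
  have hno := not_locSym_one_neg hM hI.2.1 hγ htI hsI
  have h1 := hs3.of_mem_curveStab hI.1 htI hstab
  -- If the signs differed, a stabilizing element, hence also `1`, would reverse a germ.
  have hεδ : ε = δ := by
    rcases hδ with rfl | rfl <;> rcases hε with rfl | rfl
    · rfl
    · exact (hno (by simpa using h1)).elim
    · exact (hno (by simpa using h1)).elim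
    · rfl
  subst hεδ
  exact ⟨hstab, hpos, hneg, hent, hexit⟩

/-- If the end points of `A` are reflection points, then the group elements of the decomposition
are given by alternating words. -/
theorem sim_altWord (h : IsADecomposition E γ I A lo hi a g)
    (hM : ∀ g : G, ContMDiff 𝓘(ℝ, E) 𝓘(ℝ, E) ω (fun x : M => g • x)) (hI : IsOpenIntvl I)
    (hγ : ∀ t ∈ I, ImmersedAt E γ t) (h₁ : IsReflectionPoint G γ I (a 1))
    (h₂ : IsReflectionPoint G γ I (a (-1))) {e : ℤ} (he : e = 1 ∨ e = -1) (k : ℕ)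
    (hk : e * ((k : ℤ) + 1) ∈ decompIndex lo hi) :
    (g (e * ((k : ℤ) + 1)))⁻¹ * altWord g (e * ((k : ℤ) + 1)) ∈ curveStab G γ I ∧
    ((-1 : ℤ) ^ (k + 1) = 1 → SimPos (fun t => g (e * ((k : ℤ) + 1)) • γ t) A γ
      (decompPiece I lo hi a (e * ((k : ℤ) + 1)))) ∧
    ((-1 : ℤ) ^ (k + 1) = -1 → SimNeg (fun t => g (e * ((k : ℤ) + 1)) • γ t) A γ
      (decompPiece I lo hi a (e * ((k : ℤ) + 1)))) ∧
    (e * ((k : ℤ) + 1) + e ∈ decompIndex lo hi →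
      LocSym γ (g (e * ((k : ℤ) + 1))) (((-1 : ℤ) ^ (k + 1) : ℤ) : ℝ) (a ((-1) ^ (k + 1) * e))
        (a (e * ((k : ℤ) + 1) + e))) := by
  have hone : ∀ c : ℤ, c = 1 ∨ c = -1 → c ∈ decompIndex lo hi := by
    rintro c (rfl | rfl)
    · exact h.decomp.one_mem
    · exact h.decomp.neg_one_mem
  -- Comparison with an arbitrary reflection at `a c` shows that `g c` itself reverses the germ
  -- there.
  have hbase : ∀ c : ℤ, c = 1 ∨ c = -1 →
      LocSym γ (g c) (-1) (a c) (a c) ∧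
      (SimNeg (fun t => g c • γ t) A γ (decompPiece I lo hi a c)) ∧
      (c + c ∈ decompIndex lo hi → LocSym γ (g c) (-1) (a (-c)) (a (c + c))) := by
    intro c hc
    obtain ⟨s, -, hs⟩ : IsReflectionPoint G γ I (a c) := by
      rcases hc with rfl | rfl
      · exact h₁
      · exact h₂
    have := h.sim_of_locSym hM hI hγ (n := c) (e := c) (δ := -1) (hone c hc) hc
      (by rcases hc with rfl | rfl <;> norm_num) (Or.inr rfl) (k := s) (by simpa using hs)
    obtain ⟨-, -, h3, h4, h5⟩ := this
    exact ⟨by simpa using h4, h3 rfl, by simpa using h5⟩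
  induction k with
  | zero =>
    obtain ⟨-, h4, h5⟩ := hbase e he
    simp only [Nat.cast_zero, zero_add, mul_one, pow_one, Int.reduceNeg, neg_mul, one_mul]
    refine ⟨?_, by norm_num, fun _ => h4, by simpa using h5⟩
    rw [altWord_of_eq g he, inv_mul_cancel]
    exact one_mem _
  | succ k ih =>
    have hstep : e * (((k + 1 : ℕ) : ℤ) + 1) = e * ((k : ℤ) + 1) + e := by push_cast; ring
    have hk' : e * ((k : ℤ) + 1) ∈ decompIndex lo hi := by
      rcases he with rfl | rfl
      · exact mem_decompIndex_of_le hk h.decomp.lo_neg (by omega) (by omega)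
      · exact mem_decompIndex_of_ge hk h.decomp.hi_pos (by omega) (by omega)
    obtain ⟨hstab, -, -, hexit⟩ := ih hk'
    have hexit := hexit (hstep ▸ hk)
    set δ : ℤ := (-1) ^ (k + 1) with hδ
    have hδ1 : δ = 1 ∨ δ = -1 := neg_one_pow_eq_or ℤ (k + 1)
    have hδ2 : (-1 : ℤ) ^ (k + 1 + 1) = -δ := by rw [hδ, pow_succ _ (k + 1)]; ring
    have hδe : δ * e = 1 ∨ δ * e = -1 := by
      rcases hδ1 with h1 | h1 <;> rcases he with rfl | rfl <;> rw [h1] <;> norm_num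
    -- By induction the word may replace the group element, as they differ by a stabilizing one.
    -- Precomposing with the reflection at `a (δ * e)` gives the word for the next piece, with
    -- orientation `-δ`.
    have hw := hexit.mul_right hI.1 (h.decomp.mem (hone _ hδe)) hstab
    rw [mul_inv_cancel_left] at hw
    have hw' := hw.comp (hbase _ hδe).1
    rw [← hstep] at hw'
    rw [altWord_succ g he, hδ2]
    obtain ⟨c1, c2, c3, -, c5⟩ := h.sim_of_locSym hM hI hγ (δ := -δ) hk he
      (by rcases he with rfl | rfl <;> push_cast <;> omega)
      (by rcases hδ1 with h1 | h1 <;> rw [h1] <;> norm_num) (k := _)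
      (by
        have h3 : -(-δ * e) = δ * e := by ring
        have h4 : ((-δ : ℤ) : ℝ) = (δ : ℝ) * -1 := by push_cast; ring
        rw [h3, h4]
        exact hw')
    exact ⟨c1, c2, c3, c5⟩

end IsADecomposition

end Words

theorem mainTheorem5
    {E : Type*} [NormedAddCommGroup E] [NormedSpace ℝ E] [FiniteDimensional ℝ E]
    {M : Type*} [TopologicalSpace M] [T2Space M] [SecondCountableTopology M]
    [ChartedSpace E M] [IsManifold 𝓘(ℝ, E) ω M]
    {F : Type*} [NormedAddCommGroup F] [NormedSpace ℝ F] [FiniteDimensional ℝ F]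
    {G : Type*} [TopologicalSpace G] [T2Space G] [SecondCountableTopology G]
    [ChartedSpace F G] [Group G] [LieGroup 𝓘(ℝ, F) ω G]
    [MulAction G M]
    (hG : ∀ x : M, ContMDiff 𝓘(ℝ, F) 𝓘(ℝ, E) ω (fun g : G => g • x))
    (hM : ∀ g : G, ContMDiff 𝓘(ℝ, E) 𝓘(ℝ, E) ω (fun x : M => g • x))
    (hsated : IsSated G M)
    (γ : ℝ → M) (I : Set ℝ) (hI : IsOpenIntvl I)
    (himm : IsAnalyticImmersion E γ I)
    (hfree : IsFreeCurve G E γ I)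
    (hneg : IsNegativeCurve G E γ I)
    (A : Set ℝ) (lo : WithBot ℤ) (hi : WithTop ℤ) (a : ℤ → ℝ) (g : ℤ → G)
    (hdec : IsADecomposition E γ I A lo hi a g) :
    (∀ B : Set ℝ, IsMaximalIntvl G E γ I B ↔
      ∃ n : ℤ, (n = 0 ∨ n ∈ decompIndex lo hi) ∧ B = decompPiece I lo hi a n) ∧
    (∀ n ∈ decompIndex lo hi,
      SimSign n (fun t => g n • γ t) A γ (decompPiece I lo hi a n) ∧
      curveClass γ I (g n) = curveClass γ I (altWord g n)) := by
  have hγ : ∀ t ∈ I, ImmersedAt E γ t := fun t ht => himm.immersedAt hI.1 ht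
  obtain ⟨h₁, h₂⟩ := hdec.isReflectionPoint_of_isNegativeCurve hsated hM hI hγ hneg
  refine ⟨hdec.isMaximalIntvl_iff hsated hM hI hγ
    fun n hn => hdec.isReflectionPoint hM hI hγ h₁ h₂ hn, fun n hn => ?_⟩
  obtain ⟨e, he, k, rfl⟩ : ∃ e : ℤ, (e = 1 ∨ e = -1) ∧ ∃ k : ℕ, n = e * ((k : ℤ) + 1) := by
    rcases lt_or_gt_of_ne hn.1 with h0 | h0
    · exact ⟨-1, Or.inr rfl, n.natAbs - 1, by omega⟩
    · exact ⟨1, Or.inl rfl, n.natAbs - 1, by omega⟩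
  obtain ⟨hw, hpos, hneg', -⟩ := hdec.sim_altWord hM hI hγ h₁ h₂ he k hn
  have hpar : Even (e * ((k : ℤ) + 1)) ↔ Even (k + 1) := by
    rw [Int.even_mul]
    have : ¬ Even e := by rcases he with rfl | rfl <;> decide
    simp only [this, false_or]
    exact_mod_cast Iff.rfl
  refine ⟨⟨fun hev => hpos (hpar.1 hev).neg_one_pow, fun hodd => hneg' ?_⟩,
    curveClass_eq_iff.2 hw⟩
  refine Odd.neg_one_pow (Nat.not_even_iff_odd.1 fun hev => ?_)
  exact (Int.not_even_iff_odd.2 hodd) (hpar.2 hev)
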